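/- For an integrable $f:\mathbb{R}\to\mathbb{C}$ write $\hat f(\xi)=\int_{\mathbb{R}} f(x)e^{-2\pi i x\xi}\,dx$, and let \[ \mathcal{H}=\Bigl\{f\in L^2(\mathbb{R}):\ \int_{\mathbb{R}}(1+x^2)|f(x)|^2\,dx+\int_{\mathbb{R}}(1+\xi^2)|\hat f(\xi)|^2\,d\xi<\infty\Bigr\}, \] whose elements are identified with their continuous representatives. Call $S:[0,\infty)\to[0,\infty)$ \emph{subexponentially admissible} if it is convex, (strictly) increasing, three times continuously differentiable, the function $t\mapsto\frac{d}{dt}S^2(t)$ is log-concave on $[T_0,\infty)$ for some $T_0>0$, and \[ \int_{\mathbb{R}}\frac{|\log\max\{S^2(|t|),1\}|}{1+t^2}\,dt<\infty . \] Write $S^{-1}(y)=\inf\{x\ge 0: S(x)\ge y\}$, which is the inverse function of $S$ on $[S(0),\infty)$ and is $0$ on $[0,S(0)]$. \textbf{Corollary.} Let $S$ be subexponentially admissible and let $\nu:[0,\infty)\to[0,\infty)$ be a function with $\lim_{t\to\infty}\nu(t)=\infty$. Let $\Lambda=(\lambda_j)_{j\in\mathbb{Z}}$ and $M=(\mu_j)_{j\in\mathbb{Z}}$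 be strictly increasing sequences of real numbers with $\lim_{j\to\pm\infty}\lambda_j=\pm\infty$ and $\lim_{j\to\pm\infty}\mu_j=\pm\infty$. Suppose that there is an $N\in\mathbb{N}$ with \[ \sup_{|j|\ge N}S\bigl(|\lambda_j|+\nu(|\lambda_j|)\bigr)(\lambda_{j+1}-\lambda_j)\le\tfrac12 \quad\text{and}\quad \sup_{|j|\ge N}S^{-1}\bigl(|\mu_j|+\nu(|\mu_j|)\bigr)(\mu_{j+1}-\mu_j)\le\tfrac12 . \] Then the complex vector space of all $f\in\mathcal{H}$ with $f(\lambda_j)=0$ and $\hat f(\mu_j)=0$ for all $j\in\mathbb{Z}$ is finite-dimensional. -/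

import Mathlib

open MeasureTheory Set Filter Topology
open scoped FourierTransform

/-- `g` is log-concave (and positive) on `s`. -/
structure LogConcaveOn (s : Set ℝ) (g : ℝ → ℝ) : Prop where
  pos : ∀ t ∈ s, 0 < g t
  concaveOn_log : ConcaveOn ℝ s (fun t => Real.log (g t))

/-- Subexponentially admissible functions `S : [0, ∞) → [0, ∞)`. The function is given by a total
function `ℝ → ℝ` of which only the values on `[0, ∞)` are used. The integral over the whole line
refers to the even extension `t ↦ S |t|`. -/
structure SubexponentiallyAdmissible (S : ℝ → ℝ) : Prop where
  nonneg : ∀ t, 0 ≤ t → 0 ≤ S t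
  convexOn : ConvexOn ℝ (Ici 0) S
  strictMonoOn : StrictMonoOn S (Ici 0)
  contDiffOn : ContDiffOn ℝ 3 S (Ici 0)
  logConcave : ∃ T₀ : ℝ, 0 < T₀ ∧ LogConcaveOn (Ici T₀) (deriv (fun t => S t ^ 2))
  integrable_log :
    Integrable (fun t : ℝ => |Real.log (max (S |t| ^ 2) 1)| / (1 + t ^ 2)) volume

/-- The inverse `S⁻¹(y) = inf {x ≥ 0 : S(x) ≥ y}` of an increasing function on `[0, ∞)`. For a
continuous, strictly increasing, unbounded `S` it is the inverse function on `[S(0), ∞)`, and it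
is `0` on `[0, S(0)]`. -/
noncomputable def increasingInverse (S : ℝ → ℝ) (y : ℝ) : ℝ :=
  sInf {x : ℝ | 0 ≤ x ∧ y ≤ S x}

/-- `(a_j)` is a strictly increasing two-sided sequence with `a_j → ±∞` as `j → ±∞`. -/
structure IsOrderedSequence (a : ℤ → ℝ) : Prop where
  strictMono : StrictMono a
  tendsto_atTop : Tendsto a atTop atTop
  tendsto_atBot : Tendsto a atBot atBot

/-- Membership in the Fourier symmetric Sobolev space. An element of that space is an `L²` class
with a unique continuous representative, and it is represented by that function, so that its
values at points make sense. The weight makes `f` integrable, so that `𝓕 f` is the integral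
`∫ f(x) exp(-2πixξ) dx`. -/
structure MemFourierSobolev (f : ℝ → ℂ) : Prop where
  continuous : Continuous f
  memLp : MemLp f 2 volume
  integrable_weight : Integrable (fun x : ℝ => (1 + x ^ 2) * ‖f x‖ ^ 2) volume
  integrable_fourier_weight : Integrable (fun ξ : ℝ => (1 + ξ ^ 2) * ‖𝓕 f ξ‖ ^ 2) volume

namespace MemFourierSobolev

theorem integrable {f : ℝ → ℂ} (hf : MemFourierSobolev f) : Integrable f volume := by
  refine (integrable_inv_one_add_sq.add hf.integrable_weight).mono'
    hf.continuous.aestronglyMeasurable (Eventually.of_forall fun x => ?_)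
  have h1 : 0 < 1 + x ^ 2 := by positivity
  have h2 : (1 + x ^ 2)⁻¹ * (1 + x ^ 2) = 1 := inv_mul_cancel₀ h1.ne'
  have h3 : 0 < (1 + x ^ 2)⁻¹ := inv_pos.mpr h1
  simp only [Pi.add_apply]
  have h4 : 0 ≤ (1 + x ^ 2)⁻¹ * ((1 + x ^ 2) * ‖f x‖ - 1) ^ 2 := by positivity
  have h5 : (1 + x ^ 2)⁻¹ * ((1 + x ^ 2) * ‖f x‖ - 1) ^ 2
      = (1 + x ^ 2) * ‖f x‖ ^ 2 - 2 * ‖f x‖ + (1 + x ^ 2)⁻¹ := by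
    field_simp
    ring
  have h6 := norm_nonneg (f x)
  linarith

theorem continuous_fourier {f : ℝ → ℂ} (hf : MemFourierSobolev f) : Continuous (𝓕 f) :=
  VectorFourier.fourierIntegral_continuous Real.continuous_fourierChar
    (by fun_prop) hf.integrable

theorem integrable_weight_add {u v : ℝ → ℂ} (hu : Continuous u) (hv : Continuous v)
    (iu : Integrable (fun x : ℝ => (1 + x ^ 2) * ‖u x‖ ^ 2) volume)
    (iv : Integrable (fun x : ℝ => (1 + x ^ 2) * ‖v x‖ ^ 2) volume) :
    Integrable (fun x : ℝ => (1 + x ^ 2) * ‖u x + v x‖ ^ 2) volume := by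
  refine ((iu.const_mul 2).add (iv.const_mul 2)).mono'
    (by fun_prop) (Eventually.of_forall fun x => ?_)
  have h1 : 0 ≤ 1 + x ^ 2 := by positivity
  have h2 : ‖u x + v x‖ ^ 2 ≤ 2 * ‖u x‖ ^ 2 + 2 * ‖v x‖ ^ 2 := by
    have h := norm_add_le (u x) (v x)
    nlinarith [norm_nonneg (u x + v x), sq_nonneg (‖u x‖ - ‖v x‖)]
  rw [Real.norm_of_nonneg (by positivity)]
  simp only [Pi.add_apply]
  nlinarith

theorem fourier_add {f g : ℝ → ℂ} (hf : MemFourierSobolev f) (hg : MemFourierSobolev g) :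
    𝓕 (f + g) = 𝓕 f + 𝓕 g :=
  VectorFourier.fourierIntegral_add Real.continuous_fourierChar
    (by fun_prop) hf.integrable hg.integrable

theorem fourier_smul (c : ℂ) (f : ℝ → ℂ) : 𝓕 (c • f) = c • 𝓕 f :=
  VectorFourier.fourierIntegral_const_smul _ _ _ f c

theorem fourier_zero : 𝓕 (0 : ℝ → ℂ) = 0 := by
  simpa using fourier_smul 0 (0 : ℝ → ℂ)

theorem zero : MemFourierSobolev 0 where
  continuous := continuous_zero
  memLp := MemLp.zero
  integrable_weight := by simp
  integrable_fourier_weight := by simp [fourier_zero]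

theorem add {f g : ℝ → ℂ} (hf : MemFourierSobolev f) (hg : MemFourierSobolev g) :
    MemFourierSobolev (f + g) where
  continuous := hf.continuous.add hg.continuous
  memLp := hf.memLp.add hg.memLp
  integrable_weight := integrable_weight_add hf.continuous hg.continuous
    hf.integrable_weight hg.integrable_weight
  integrable_fourier_weight := by
    rw [fourier_add hf hg]
    exact integrable_weight_add hf.continuous_fourier hg.continuous_fourier
      hf.integrable_fourier_weight hg.integrable_fourier_weight

theorem smul (c : ℂ) {f : ℝ → ℂ} (hf : MemFourierSobolev f) : MemFourierSobolev (c • f) where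
  continuous := hf.continuous.const_smul c
  memLp := hf.memLp.const_smul c
  integrable_weight := by
    refine (hf.integrable_weight.const_mul (‖c‖ ^ 2)).congr (Eventually.of_forall fun x => ?_)
    simp only [Pi.smul_apply, smul_eq_mul, norm_mul]
    ring
  integrable_fourier_weight := by
    refine (hf.integrable_fourier_weight.const_mul (‖c‖ ^ 2)).congr
      (Eventually.of_forall fun x => ?_)
    simp only [fourier_smul, Pi.smul_apply, smul_eq_mul, norm_mul]
    ring

end MemFourierSobolev

/-- The Fourier symmetric Sobolev space `𝓗`, as a complex vector space of functions. -/
def fourierSobolev : Submodule ℂ (ℝ → ℂ) where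
  carrier := {f | MemFourierSobolev f}
  zero_mem' := MemFourierSobolev.zero
  add_mem' := fun hf hg => hf.add hg
  smul_mem' := fun c _ hf => hf.smul c

/-- The space of all `f ∈ 𝓗` with `f = 0` on `Λ` and `𝓕 f = 0` on `M`. -/
def vanishingSpace (Λ M : Set ℝ) : Submodule ℂ fourierSobolev where
  carrier := {f | (∀ x ∈ Λ, (f : ℝ → ℂ) x = 0) ∧ ∀ ξ ∈ M, 𝓕 (f : ℝ → ℂ) ξ = 0}
  zero_mem' := ⟨fun _ _ => rfl, fun ξ _ => congrFun MemFourierSobolev.fourier_zero ξ⟩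
  add_mem' := by
    rintro f g ⟨hf, hf'⟩ ⟨hg, hg'⟩
    refine ⟨fun x hx => ?_, fun ξ hξ => ?_⟩
    · simp [hf x hx, hg x hx]
    · rw [Submodule.coe_add, MemFourierSobolev.fourier_add f.2 g.2]
      simp [hf' ξ hξ, hg' ξ hξ]
  smul_mem' := by
    rintro c f ⟨hf, hf'⟩
    refine ⟨fun x hx => ?_, fun ξ hξ => ?_⟩
    · simp [hf x hx]
    · rw [Submodule.coe_smul, MemFourierSobolev.fourier_smul]
      simp [hf' ξ hξ]

/-!
A function `f` that vanishes on `Λ`, and whose Fourier transform vanishes on `M`, is confined to a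
bounded part of phase space. Since a bounded part of phase space carries only finitely many
degrees of freedom, such functions form a finite-dimensional space.

After subtracting `S 0` one may work with `s = S - S 0` and its inverse `T`. Wirtinger's inequality
on the gaps of `Λ` says that `∫ s(|x| + A)² |f|² ≤ ∫ ξ² |𝓕 f|²` up to a multiple of `‖f‖²`, for any
constant `A`, because the margin `ν` tends to infinity (`wirtinger_fourier`, `exists_gap_bound`,
`integral_weight_le`): heuristically `f` lives where `|ξ| > s(|x| + A)`. In the same way the gaps of
`M` push `f` into the region `|x| > T(|ξ| + A)`. The two regions are separated by the
curve `|ξ| = s(|x|)`, and the margin `A` keeps them apart.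

To make this rigorous, `f` is convolved with modulations of a compactly supported window
(`windowed`). The Fourier transform of the piece of frequency `η` is a translate of a fixed function
times `𝓕 f`, so it still vanishes on `M` and Wirtinger's inequality applies to each piece. As `s²` is
a convex function of the squared argument, it lies above its tangent lines,
`v(η) (x² - T(|η|)²) + η² ≤ s(|x|)²` (`ConvexProfile.tangentWeight_le`). Testing this inequality
against the density of the piece of frequency `η` and using Wirtinger's inequality on the left gives
a lower bound in terms of `v(η) (T(|ξ| + A)² - T(|η|)²) + η²`, which log-concavity of `(S²)'` bounds
from below by `ξ² + A |ξ| / 2` up to an error `O(|ξ| (1 + |ξ - η|³))` that is independent of `A`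
(`ConvexProfile.le_tangentWeight`). On the right, integration over `η` costs only a shift of the
weight by the width of the window, `∫ s(|x| + 1)² |f|²` (`integral_weight_windowed_le`).
For `A` large, comparison with Wirtinger's inequality for `f` itself leaves
`c ∫ |x| |f|² + ∫ |ξ| |𝓕 f|² ≤ C ∫ |f|²` (`exists_coercive_estimate`).

Finally, a function satisfying this estimate is zero as soon as its means over the
intervals of a fine enough partition of a long enough interval vanish, since the half-derivative
controls translations in `L²` (`exists_eq_zero_of_mean_zero`).
-/

/-! ### Plancherel's theorem on `L¹ ∩ L²` -/

theorem fourier_toLp_ae_eq {f : ℝ → ℂ} (hf : Integrable f) (hf2 : MemLp f 2) :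
    (𝓕 (hf2.toLp f) : Lp ℂ 2 (volume : Measure ℝ)) =ᵐ[volume] 𝓕 f := by
  have hcont : Continuous (𝓕 f) :=
    VectorFourier.fourierIntegral_continuous Real.continuous_fourierChar (by fun_prop) hf
  refine ae_eq_of_integral_contDiff_smul_eq
    ((Lp.memLp _).locallyIntegrable (by norm_num)) hcont.locallyIntegrable ?_
  intro g hg hgc
  have hgc' : HasCompactSupport (fun x => (g x : ℂ)) :=
    hgc.comp_left (g := fun y : ℝ => (y : ℂ)) (by simp)
  have hg' : ContDiff ℝ (⊤ : ℕ∞) (fun x => (g x : ℂ)) :=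
    Complex.ofRealCLM.contDiff.comp hg
  set G : SchwartzMap ℝ ℂ := hgc'.toSchwartzMap hg' with hG
  have hGx : ∀ x, G x = (g x : ℂ) := fun x => rfl
  have h1 := congrArg (fun F => F G) (Lp.fourier_toTemperedDistribution_eq (hf2.toLp f))
  simp only [TemperedDistribution.fourier_apply, Lp.toTemperedDistribution_apply] at h1
  have h2 : ∫ x, g x • (𝓕 (hf2.toLp f) : Lp ℂ 2 (volume : Measure ℝ)) x =
      ∫ x, G x • (𝓕 (hf2.toLp f) : Lp ℂ 2 (volume : Measure ℝ)) x := by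
    simp [hGx]
  have h3 : ∫ x, g x • 𝓕 f x = ∫ x, 𝓕 f x • G x := by
    simp [hGx, mul_comm]
  rw [h2, h3, ← h1]
  have h4 : ∫ ξ, 𝓕 f ξ • G ξ = ∫ x, f x • 𝓕 (G : ℝ → ℂ) x := by
    have := VectorFourier.integral_fourierIntegral_smul_eq_flip (L := innerₗ ℝ)
      (μ := volume) (ν := volume) (f := f) (g := (G : ℝ → ℂ))
      Real.continuous_fourierChar (by fun_prop) hf G.integrable
    simp only [flip_innerₗ] at this
    exact this
  rw [h4]
  refine integral_congr_ae ?_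
  filter_upwards [hf2.coeFn_toLp] with x hx
  rw [hx, SchwartzMap.fourier_coe, smul_eq_mul, smul_eq_mul, mul_comm]

theorem memLp_fourier {f : ℝ → ℂ} (hf : Integrable f) (hf2 : MemLp f 2) : MemLp (𝓕 f) 2 :=
  (memLp_congr_ae (fourier_toLp_ae_eq hf hf2)).1 (Lp.memLp _)

/-- Plancherel's theorem for the Fourier integral on `L¹ ∩ L²`. -/
theorem integral_norm_sq_fourier {f : ℝ → ℂ} (hf : Integrable f) (hf2 : MemLp f 2) :
    ∫ ξ, ‖𝓕 f ξ‖ ^ 2 = ∫ x, ‖f x‖ ^ 2 := by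
  have h := Lp.norm_fourier_eq (hf2.toLp f)
  -- the squared norm in `Lp` as an integral
  have key : ∀ F : Lp ℂ 2 (volume : Measure ℝ), ∫ x, ‖F x‖ ^ 2 = ‖F‖ ^ 2 := by
    intro F
    have h1 : (inner ℂ F F : ℂ) = ((‖F‖ ^ 2 : ℝ) : ℂ) := by
      rw [inner_self_eq_norm_sq_to_K]; norm_cast
    rw [L2.inner_def] at h1
    have h2 : ∀ x, (inner ℂ (F x) (F x) : ℂ) = ((‖F x‖ ^ 2 : ℝ) : ℂ) := by
      intro x
      rw [inner_self_eq_norm_sq_to_K]; norm_cast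
    simp_rw [h2] at h1
    rw [integral_complex_ofReal] at h1
    exact_mod_cast h1
  have h5 := key (𝓕 (hf2.toLp f))
  have h6 := key (hf2.toLp f)
  rw [h] at h5
  rw [← integral_congr_ae (f := fun x => ‖(hf2.toLp f) x‖ ^ 2) (g := fun x => ‖f x‖ ^ 2), h6, ← h5]
  · refine integral_congr_ae ?_
    filter_upwards [fourier_toLp_ae_eq hf hf2] with x hx
    rw [hx]
  · filter_upwards [hf2.coeFn_toLp] with x hx
    rw [hx]

/-! ### Wirtinger's inequality on an interval -/

/-- Wirtinger's inequality with a constant below the optimal one. For such a constant `tan` is smooth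
on the whole interval, so that a square can be completed without boundary singularities. -/
theorem wirtinger_aux {u u' : ℝ → ℂ} (hu : ∀ x, HasDerivAt u (u' x) x) (hu' : Continuous u')
    {a b : ℝ} (hab : a < b) (ha : u a = 0) (hb : u b = 0) {c : ℝ} (hc0 : 0 ≤ c)
    (hc : c * (b - a) < Real.pi) :
    c ^ 2 * ∫ x in a..b, ‖u x‖ ^ 2 ≤ ∫ x in a..b, ‖u' x‖ ^ 2 := by
  have hucont : Continuous u := continuous_iff_continuousAt.2 fun x => (hu x).continuousAt
  set m := (a + b) / 2 with hm
  set θ : ℝ → ℝ := fun x => c * (x - m) with hθ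
  have hcos : ∀ x ∈ Icc a b, Real.cos (θ x) ≠ 0 := by
    intro x hx
    apply (Real.cos_pos_of_mem_Ioo _).ne'
    constructor
    · have : c * (m - x) ≤ c * ((b - a) / 2) :=
        mul_le_mul_of_nonneg_left (by rw [hm]; linarith [hx.1]) hc0
      simp only [hθ]; nlinarith
    · have : c * (x - m) ≤ c * ((b - a) / 2) :=
        mul_le_mul_of_nonneg_left (by rw [hm]; linarith [hx.2]) hc0
      simp only [hθ]; nlinarith
  -- the derivative of `c tan θ |u|²` is the defect `c²|u|² - |u'|²` plus a square
  have hder : ∀ x ∈ Icc a b, HasDerivAt (fun x => c * Real.tan (θ x) * ‖u x‖ ^ 2)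
      (‖u' x + (c * Real.tan (θ x)) • u x‖ ^ 2 - (‖u' x‖ ^ 2 - c ^ 2 * ‖u x‖ ^ 2)) x := by
    intro x hx
    have h1 : HasDerivAt θ c x := by
      simpa using ((hasDerivAt_id x).sub_const m).const_mul c
    have h2 := ((Real.hasDerivAt_tan (hcos x hx)).comp x h1).const_mul c
    have h3 := h2.mul (hu x).norm_sq
    refine h3.congr_deriv ?_
    have h4 : 1 / Real.cos (θ x) ^ 2 = 1 + Real.tan (θ x) ^ 2 := by
      rw [Real.tan_eq_sin_div_cos]
      have := hcos x hx
      field_simp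
      rw [add_comm]; exact (Real.sin_sq_add_cos_sq _).symm
    rw [h4, @norm_add_sq_real ℂ]
    rw [norm_smul, real_inner_smul_right, real_inner_comm (u x) (u' x), Real.norm_eq_abs, mul_pow,
      sq_abs]
    simp only [Function.comp]
    ring
  have htan : ContinuousOn (fun x => Real.tan (θ x)) (Icc a b) := by
    intro x hx
    have h1 : ContinuousAt θ x := by fun_prop
    exact ((Real.continuousAt_tan.2 (hcos x hx)).comp h1).continuousWithinAt
  have hc1 : ContinuousOn (fun x => ‖u' x + (c * Real.tan (θ x)) • u x‖ ^ 2) (Icc a b) :=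
    ((hu'.continuousOn.add ((continuousOn_const.mul htan).smul hucont.continuousOn)).norm).pow 2
  have hc2 : Continuous (fun x => ‖u' x‖ ^ 2 - c ^ 2 * ‖u x‖ ^ 2) := by fun_prop
  have huIcc : uIcc a b = Icc a b := uIcc_of_le hab.le
  have i1 : IntervalIntegrable (fun x => ‖u' x + (c * Real.tan (θ x)) • u x‖ ^ 2) volume a b :=
    (huIcc ▸ hc1).intervalIntegrable
  have i2 : IntervalIntegrable (fun x => ‖u' x‖ ^ 2 - c ^ 2 * ‖u x‖ ^ 2) volume a b :=
    hc2.intervalIntegrable _ _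
  have hft := intervalIntegral.integral_eq_sub_of_hasDerivAt
    (fun x hx => hder x (huIcc ▸ hx)) (i1.sub i2)
  simp only [ha, hb] at hft
  rw [intervalIntegral.integral_sub i1 i2, intervalIntegral.integral_sub
    ((by fun_prop : Continuous fun x => ‖u' x‖ ^ 2).intervalIntegrable _ _)
    ((by fun_prop : Continuous fun x => c ^ 2 * ‖u x‖ ^ 2).intervalIntegrable _ _),
    intervalIntegral.integral_const_mul] at hft
  have hpos : 0 ≤ ∫ x in a..b, ‖u' x + (c * Real.tan (θ x)) • u x‖ ^ 2 :=
    intervalIntegral.integral_nonneg hab.le fun x _ => by positivity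
  rw [norm_zero, zero_pow two_ne_zero, mul_zero, mul_zero, sub_zero] at hft
  linarith

/-- **Wirtinger's inequality** for functions vanishing at both ends of an interval. -/
theorem wirtinger {u u' : ℝ → ℂ} (hu : ∀ x, HasDerivAt u (u' x) x) (hu' : Continuous u')
    {a b : ℝ} (hab : a < b) (ha : u a = 0) (hb : u b = 0) :
    (Real.pi / (b - a)) ^ 2 * ∫ x in a..b, ‖u x‖ ^ 2 ≤ ∫ x in a..b, ‖u' x‖ ^ 2 := by
  have hba : 0 < b - a := sub_pos.2 hab
  have hlim : Tendsto (fun c : ℝ => c ^ 2 * ∫ x in a..b, ‖u x‖ ^ 2) (𝓝[<] (Real.pi / (b - a)))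
      (𝓝 ((Real.pi / (b - a)) ^ 2 * ∫ x in a..b, ‖u x‖ ^ 2)) :=
    ((continuous_id.pow 2).mul continuous_const).continuousAt.tendsto.mono_left nhdsWithin_le_nhds
  refine le_of_tendsto hlim ?_
  have hpos : 0 < Real.pi / (b - a) := div_pos Real.pi_pos hba
  filter_upwards [Ioo_mem_nhdsLT hpos] with c hc
  exact wirtinger_aux hu hu' hab ha hb hc.1.le ((lt_div_iff₀ hba).1 hc.2)

/-- Wirtinger's inequality for a function minus the affine function with the same boundary
values. It applies to approximations of `u` whose boundary values vanish only in the limit. -/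
theorem wirtinger_sub_affine {u u' : ℝ → ℂ} (hu : ∀ x, HasDerivAt u (u' x) x)
    (hu' : Continuous u') {a b : ℝ} (hab : a < b) :
    (Real.pi / (b - a)) ^ 2 *
      ∫ x in a..b, ‖u x - (u a + ((x - a) / (b - a)) • (u b - u a))‖ ^ 2 ≤
      ∫ x in a..b, ‖u' x‖ ^ 2 := by
  have hba : 0 < b - a := sub_pos.2 hab
  set m : ℂ := (b - a)⁻¹ • (u b - u a) with hm
  have hder : ∀ x, HasDerivAt (fun x => u x - (u a + ((x - a) / (b - a)) • (u b - u a)))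
      (u' x - m) x := by
    intro x
    have h1 : HasDerivAt (fun x : ℝ => (x - a) / (b - a)) ((b - a)⁻¹) x := by
      simpa using ((hasDerivAt_id x).sub_const a).div_const (b - a)
    exact (hu x).sub ((h1.smul_const (u b - u a)).const_add (u a))
  refine (wirtinger hder (hu'.sub continuous_const) hab (by simp)
    (by simp [div_self hba.ne'])).trans ?_
  have hint : ∫ x in a..b, u' x = u b - u a :=
    intervalIntegral.integral_eq_sub_of_hasDerivAt (fun x _ => hu x) (hu'.intervalIntegrable _ _)
  have hexp : ∀ x, ‖u' x - m‖ ^ 2 = ‖u' x‖ ^ 2 - 2 * (innerSL ℝ m) (u' x) + ‖m‖ ^ 2 := by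
    intro x
    rw [@norm_sub_sq_real ℂ, real_inner_comm]; rfl
  simp_rw [hexp]
  have c1 : Continuous fun x => (innerSL ℝ m) (u' x) := (innerSL ℝ m).continuous.comp hu'
  rw [intervalIntegral.integral_add
      ((by fun_prop : Continuous fun x =>
        ‖u' x‖ ^ 2 - 2 * (innerSL ℝ m) (u' x)).intervalIntegrable _ _)
      (continuous_const.intervalIntegrable _ _),
    intervalIntegral.integral_sub
      ((by fun_prop : Continuous fun x => ‖u' x‖ ^ 2).intervalIntegrable _ _)
      ((by fun_prop : Continuous fun x => 2 * (innerSL ℝ m) (u' x)).intervalIntegrable _ _),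
    intervalIntegral.integral_const_mul,
    ContinuousLinearMap.intervalIntegral_comp_comm _ (hu'.intervalIntegrable _ _), hint,
    intervalIntegral.integral_const]
  have h7 : u b - u a = (b - a) • m := by
    rw [hm, smul_smul, mul_inv_cancel₀ hba.ne', one_smul]
  rw [h7, map_smul, innerSL_apply_apply, real_inner_self_eq_norm_sq, smul_eq_mul]
  have : 0 ≤ (b - a) * ‖m‖ ^ 2 := by positivity
  linarith

/-! ### Wirtinger's inequality for Fourier transforms -/

theorem norm_fourier_le (φ : ℝ → ℂ) (ξ : ℝ) : ‖𝓕 φ ξ‖ ≤ ∫ x, ‖φ x‖ :=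
  VectorFourier.norm_fourierIntegral_le_integral_norm _ _ _ _ _

theorem continuous_fourier_of_integrable {φ : ℝ → ℂ} (hφ : Integrable φ) : Continuous (𝓕 φ) :=
  VectorFourier.fourierIntegral_continuous Real.continuous_fourierChar (by fun_prop) hφ

theorem tendsto_fourier_indicator {φ : ℝ → ℂ} (hφ : Integrable φ) (ξ : ℝ) :
    Tendsto (fun n : ℕ => 𝓕 ((Icc (-(n : ℝ)) n).indicator φ) ξ) atTop (𝓝 (𝓕 φ ξ)) := by
  simp only [Real.fourier_eq]
  refine tendsto_integral_of_dominated_convergence (fun x => ‖φ x‖) (fun n => ?_) hφ.norm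
    (fun n => Eventually.of_forall fun x => ?_) (Eventually.of_forall fun x => ?_)
  · exact ((Real.fourierIntegral_convergent_iff ξ).2
      (hφ.indicator measurableSet_Icc)).aestronglyMeasurable
  · rw [Circle.norm_smul]
    exact norm_indicator_le_norm_self _ _
  · refine tendsto_const_nhds.congr' ?_
    filter_upwards [eventually_ge_atTop ⌈|x|⌉₊] with n hn
    have h1 : |x| ≤ n := (Nat.le_ceil _).trans (by exact_mod_cast hn)
    rw [indicator_of_mem (show x ∈ Icc (-(n : ℝ)) n from abs_le.1 h1)]

/-- The derivative of the Fourier transform of a truncated function, with its `L²` bound. -/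
theorem exists_deriv_fourier_indicator {φ : ℝ → ℂ} (hφ : Integrable φ)
    (hx : Integrable fun x : ℝ => x ^ 2 * ‖φ x‖ ^ 2) (n : ℕ) :
    ∃ u' : ℝ → ℂ, Continuous u' ∧
      (∀ ξ, HasDerivAt (𝓕 ((Icc (-(n : ℝ)) n).indicator φ)) (u' ξ) ξ) ∧
      Integrable (fun ξ => ‖u' ξ‖ ^ 2) ∧
      ∫ ξ, ‖u' ξ‖ ^ 2 ≤ (2 * Real.pi) ^ 2 * ∫ x, x ^ 2 * ‖φ x‖ ^ 2 := by
  set φn : ℝ → ℂ := (Icc (-(n : ℝ)) n).indicator φ with hφn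
  have iφn : Integrable φn := hφ.indicator measurableSet_Icc
  have hle : ∀ x, ‖φn x‖ ≤ ‖φ x‖ := fun x => norm_indicator_le_norm_self _ _
  have hxle : ∀ x, |x| * ‖φn x‖ ≤ n * ‖φ x‖ := by
    intro x
    by_cases h : x ∈ Icc (-(n : ℝ)) n
    · exact mul_le_mul (abs_le.2 h) (hle x) (norm_nonneg _) (by positivity)
    · simp only [hφn, indicator_of_notMem h, norm_zero, mul_zero]; positivity
  have ixφ : Integrable fun x : ℝ => x • φn x := by
    refine (hφ.norm.const_mul (n : ℝ)).mono'
      (continuous_id.aestronglyMeasurable.smul iφn.aestronglyMeasurable)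
      (Eventually.of_forall fun x => ?_)
    rw [norm_smul]; exact hxle x
  set ψ : ℝ → ℂ := fun x : ℝ => (-2 * Real.pi * Complex.I * x) • φn x with hψ
  have iψ : Integrable ψ := by
    refine (ixφ.const_mul (-2 * Real.pi * Complex.I)).congr (Eventually.of_forall fun x => ?_)
    simp only [hψ, smul_eq_mul, Complex.real_smul]; ring
  have nψ : ∀ x, ‖ψ x‖ ^ 2 = (2 * Real.pi) ^ 2 * (x ^ 2 * ‖φn x‖ ^ 2) := by
    intro x
    simp only [hψ, norm_smul, norm_mul, norm_neg, Complex.norm_I, Complex.norm_real,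
      Complex.norm_ofNat, Real.norm_eq_abs, abs_of_pos Real.pi_pos, mul_one, mul_pow, sq_abs]
    ring
  have iφ2 : Integrable fun x : ℝ => x ^ 2 * ‖φn x‖ ^ 2 := by
    refine hx.mono' ((continuous_id.pow 2).aestronglyMeasurable.mul
      (iφn.aestronglyMeasurable.norm.pow 2)) (Eventually.of_forall fun x => ?_)
    rw [Real.norm_of_nonneg (by positivity)]
    gcongr
    exact hle x
  have iψ2 : Integrable fun x => ‖ψ x‖ ^ 2 := by
    simp_rw [nψ]; exact iφ2.const_mul _
  have mψ : MemLp ψ 2 := (memLp_two_iff_integrable_sq_norm iψ.aestronglyMeasurable).2 iψ2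
  refine ⟨𝓕 ψ, continuous_fourier_of_integrable iψ,
    fun ξ => Real.hasDerivAt_fourier iφn ixφ ξ, ?_, ?_⟩
  · exact (memLp_two_iff_integrable_sq_norm
      (continuous_fourier_of_integrable iψ).aestronglyMeasurable).1 (memLp_fourier iψ mψ)
  · rw [integral_norm_sq_fourier iψ mψ]
    simp_rw [nψ]
    rw [integral_const_mul]
    refine mul_le_mul_of_nonneg_left (integral_mono iφ2 hx fun x => ?_) (by positivity)
    dsimp only
    gcongr
    exact hle x

/-- Wirtinger's inequality on finitely many consecutive intervals, for the Fourier transform of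
a function with finite second moment. That function is truncated, so that its Fourier transform is
continuously differentiable; the boundary values reappear as affine corrections, which vanish in the
limit. -/
theorem sum_wirtinger_fourier {φ : ℝ → ℂ} (hφ : Integrable φ)
    (hx : Integrable fun x : ℝ => x ^ 2 * ‖φ x‖ ^ 2) {b : ℕ → ℝ} (hb : StrictMono b)
    (hz : ∀ i, 𝓕 φ (b i) = 0) (K : ℕ) :
    ∑ i ∈ Finset.range K, (1 / (2 * (b (i + 1) - b i))) ^ 2 *
      ∫ ξ in (b i)..(b (i + 1)), ‖𝓕 φ ξ‖ ^ 2 ≤ ∫ x, x ^ 2 * ‖φ x‖ ^ 2 := by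
  set h : ℕ → ℝ → ℂ := fun n => 𝓕 ((Icc (-(n : ℝ)) n).indicator φ) with hh
  have hgap : ∀ i, 0 < b (i + 1) - b i := fun i => sub_pos.2 (hb (Nat.lt_succ_self i))
  set M := ∫ x, ‖φ x‖ with hM
  have hbound : ∀ n x, ‖h n x‖ ≤ M := by
    intro n x
    refine (norm_fourier_le _ _).trans (integral_mono_of_nonneg
      (Eventually.of_forall fun x => norm_nonneg _) hφ.norm
      (Eventually.of_forall fun x => norm_indicator_le_norm_self _ _))
  have hcont : ∀ n, Continuous (h n) := fun n =>
    continuous_fourier_of_integrable (hφ.indicator measurableSet_Icc)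
  set lin : ℕ → ℕ → ℝ → ℂ := fun i n x =>
    h n (b i) + ((x - b i) / (b (i + 1) - b i)) • (h n (b (i + 1)) - h n (b i)) with hlin
  have hlim : ∀ i, Tendsto (fun n => (1 / (2 * (b (i + 1) - b i))) ^ 2 *
      ∫ ξ in (b i)..(b (i + 1)), ‖h n ξ - lin i n ξ‖ ^ 2) atTop
      (𝓝 ((1 / (2 * (b (i + 1) - b i))) ^ 2 *
      ∫ ξ in (b i)..(b (i + 1)), ‖𝓕 φ ξ‖ ^ 2)) := by
    intro i
    refine Tendsto.const_mul _ ?_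
    refine intervalIntegral.tendsto_integral_filter_of_dominated_convergence
      (fun _ => (4 * M) ^ 2) (Eventually.of_forall fun n => ?_) (Eventually.of_forall fun n => ?_)
      intervalIntegrable_const ?_
    · have := hcont n
      have : Continuous fun ξ => ‖h n ξ - lin i n ξ‖ ^ 2 := by
        simp only [hlin]; fun_prop
      exact this.aestronglyMeasurable
    · refine Eventually.of_forall fun x hxI => ?_
      rw [uIoc_of_le (hb.monotone (Nat.le_succ i))] at hxI
      rw [norm_pow, norm_norm]
      have h1 : |(x - b i) / (b (i + 1) - b i)| ≤ 1 := by
        rw [abs_div, abs_of_pos (hgap i), div_le_one (hgap i), abs_of_pos (sub_pos.2 hxI.1)]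
        linarith [hxI.2]
      have h2 : ‖((x - b i) / (b (i + 1) - b i)) • (h n (b (i + 1)) - h n (b i))‖ ≤ M + M := by
        rw [norm_smul, Real.norm_eq_abs]
        have h3 := (norm_sub_le (h n (b (i + 1))) (h n (b i))).trans
          (add_le_add (hbound n _) (hbound n _))
        calc _ ≤ 1 * (M + M) := mul_le_mul h1 h3 (norm_nonneg _) zero_le_one
          _ = M + M := one_mul _
      have h4 : ‖h n x - lin i n x‖ ≤ 4 * M := by
        calc ‖h n x - lin i n x‖ ≤ ‖h n x‖ + ‖lin i n x‖ := norm_sub_le _ _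
          _ ≤ M + (M + (M + M)) := add_le_add (hbound n x) ((norm_add_le _ _).trans
              (add_le_add (hbound n _) h2))
          _ = 4 * M := by ring
      gcongr
    · refine Eventually.of_forall fun x _ => ?_
      have t := fun ξ => tendsto_fourier_indicator hφ ξ
      have t1 : Tendsto (fun n => h n x - lin i n x) atTop (𝓝 (𝓕 φ x - (𝓕 φ (b i) +
          ((x - b i) / (b (i + 1) - b i)) • (𝓕 φ (b (i + 1)) - 𝓕 φ (b i))))) :=
        (t x).sub ((t (b i)).add (((t (b (i + 1))).sub (t (b i))).const_smul _))
      simp only [hz, sub_zero, smul_zero, add_zero] at t1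
      exact t1.norm.pow 2
  refine le_of_tendsto (tendsto_finsetSum _ fun i _ => hlim i) (Eventually.of_forall fun n => ?_)
  obtain ⟨u', hu'c, hu', hi, hle⟩ := exists_deriv_fourier_indicator hφ hx n
  have hpi : (0 : ℝ) < (2 * Real.pi) ^ 2 := by positivity
  rw [← mul_le_mul_iff_right₀ hpi]
  refine le_trans ?_ hle
  calc _ = ∑ i ∈ Finset.range K, (Real.pi / (b (i + 1) - b i)) ^ 2 *
        ∫ ξ in (b i)..(b (i + 1)), ‖h n ξ - lin i n ξ‖ ^ 2 := by
        rw [Finset.mul_sum]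
        refine Finset.sum_congr rfl fun i _ => ?_
        have := (hgap i).ne'
        rw [← mul_assoc]
        congr 1
        field_simp
    _ ≤ ∑ i ∈ Finset.range K, ∫ ξ in (b i)..(b (i + 1)), ‖u' ξ‖ ^ 2 :=
        Finset.sum_le_sum fun i _ => wirtinger_sub_affine hu' hu'c (hb (Nat.lt_succ_self i))
    _ = ∫ ξ in (b 0)..(b K), ‖u' ξ‖ ^ 2 :=
        intervalIntegral.sum_integral_adjacent_intervals fun i _ =>
          (hu'c.norm.pow 2).intervalIntegrable _ _
    _ ≤ ∫ ξ, ‖u' ξ‖ ^ 2 := by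
        rw [intervalIntegral.integral_of_le (hb.monotone (Nat.zero_le K))]
        exact setIntegral_le_integral hi (Eventually.of_forall fun x => by positivity)

/-- **Wirtinger's inequality on the Fourier side.** If `𝓕 φ` vanishes along a sequence whose gaps
are at most `1 / (2q)`, then `q 𝓕 φ` is controlled in `L²` by `x φ`. -/
theorem wirtinger_fourier {φ : ℝ → ℂ} (hφ : Integrable φ)
    (hx : Integrable fun x : ℝ => x ^ 2 * ‖φ x‖ ^ 2) {a : ℤ → ℝ} (ha : IsOrderedSequence a)
    (hz : ∀ j, 𝓕 φ (a j) = 0) {q : ℝ → ℝ} (hqm : Measurable q) (hq0 : ∀ x, 0 ≤ q x)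
    (hq : ∀ j, ∀ x ∈ Icc (a j) (a (j + 1)), q x * (a (j + 1) - a j) ≤ 1 / 2) :
    Integrable (fun ξ => q ξ ^ 2 * ‖𝓕 φ ξ‖ ^ 2) ∧
      ∫ ξ, q ξ ^ 2 * ‖𝓕 φ ξ‖ ^ 2 ≤ ∫ x, x ^ 2 * ‖φ x‖ ^ 2 := by
  have hc := continuous_fourier_of_integrable hφ
  have hcast : Tendsto (fun n : ℕ => (n : ℤ)) atTop atTop := tendsto_natCast_atTop_atTop
  have hcover : AECover volume atTop fun n : ℕ => Ioc (a (-(n : ℤ))) (a n) :=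
    aecover_Ioc (ha.tendsto_atBot.comp (tendsto_neg_atTop_atBot.comp hcast))
      (ha.tendsto_atTop.comp hcast)
  have hgap : ∀ j, 0 < a (j + 1) - a j := fun j => sub_pos.2 (ha.strictMono (lt_add_one j))
  have hpt : ∀ j, ∀ x ∈ Icc (a j) (a (j + 1)), q x ^ 2 ≤ (1 / (2 * (a (j + 1) - a j))) ^ 2 := by
    intro j x hxj
    refine pow_le_pow_left₀ (hq0 x) ?_ 2
    rw [le_div_iff₀ (by linarith [hgap j])]
    linarith [hq j x hxj]
  have hii : ∀ j, IntervalIntegrable (fun ξ => q ξ ^ 2 * ‖𝓕 φ ξ‖ ^ 2) volume (a j) (a (j + 1)) := by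
    intro j
    have h1 : IntervalIntegrable (fun ξ => (1 / (2 * (a (j + 1) - a j))) ^ 2 * ‖𝓕 φ ξ‖ ^ 2)
        volume (a j) (a (j + 1)) :=
      (by fun_prop : Continuous fun ξ =>
        (1 / (2 * (a (j + 1) - a j))) ^ 2 * ‖𝓕 φ ξ‖ ^ 2).intervalIntegrable _ _
    refine h1.mono_fun' ((hqm.pow_const 2).aestronglyMeasurable.mul
      (hc.norm.pow 2).aestronglyMeasurable) ?_
    rw [uIoc_of_le (sub_nonneg.1 (hgap j).le)]
    filter_upwards [ae_restrict_mem measurableSet_Ioc] with x hxI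
    rw [Real.norm_of_nonneg (by positivity)]
    exact mul_le_mul_of_nonneg_right (hpt j x ⟨hxI.1.le, hxI.2⟩) (by positivity)
  have hfin : ∀ n : ℕ, IntegrableOn (fun ξ => q ξ ^ 2 * ‖𝓕 φ ξ‖ ^ 2)
      (Ioc (a (-(n : ℤ))) (a n)) ∧
      ∫ ξ in Ioc (a (-(n : ℤ))) (a n), q ξ ^ 2 * ‖𝓕 φ ξ‖ ^ 2 ≤ ∫ x, x ^ 2 * ‖φ x‖ ^ 2 := by
    intro n
    set b : ℕ → ℝ := fun i => a (-(n : ℤ) + i) with hb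
    have hbm : StrictMono b := ha.strictMono.comp fun i j hij => by simpa using hij
    have hb1 : ∀ i, b (i + 1) = a (-(n : ℤ) + i + 1) := fun i => by
      simp only [hb]; congr 1; push_cast; ring
    have hb0 : b 0 = a (-(n : ℤ)) := by simp [hb]
    have hbn : b (2 * n) = a n := by simp only [hb]; congr 1; push_cast; ring
    have hii' : ∀ i, IntervalIntegrable (fun ξ => q ξ ^ 2 * ‖𝓕 φ ξ‖ ^ 2) volume
        (b i) (b (i + 1)) := fun i => by rw [hb1]; exact hii _
    have hle : a (-(n : ℤ)) ≤ a n := ha.strictMono.monotone (by omega)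
    have hI : IntervalIntegrable (fun ξ => q ξ ^ 2 * ‖𝓕 φ ξ‖ ^ 2) volume (b 0) (b (2 * n)) :=
      IntervalIntegrable.trans_iterate fun i _ => hii' i
    rw [hb0, hbn] at hI
    refine ⟨(intervalIntegrable_iff_integrableOn_Ioc_of_le hle).1 hI, ?_⟩
    rw [← intervalIntegral.integral_of_le hle, ← hb0, ← hbn,
      ← intervalIntegral.sum_integral_adjacent_intervals fun i _ => hii' i]
    refine le_trans (Finset.sum_le_sum fun i _ => ?_)
      (sum_wirtinger_fourier hφ hx hbm (fun i => hz _) (2 * n))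
    rw [← intervalIntegral.integral_const_mul]
    refine intervalIntegral.integral_mono_on (hbm.monotone (Nat.le_succ i)) (hii' i)
      ((by fun_prop : Continuous fun ξ =>
        (1 / (2 * (b (i + 1) - b i))) ^ 2 * ‖𝓕 φ ξ‖ ^ 2).intervalIntegrable _ _) fun x hxi => ?_
    rw [hb1] at hxi ⊢
    exact mul_le_mul_of_nonneg_right (hpt _ x hxi) (by positivity)
  have hint : Integrable fun ξ => q ξ ^ 2 * ‖𝓕 φ ξ‖ ^ 2 :=
    hcover.integrable_of_integral_bounded_of_nonneg_ae _ (fun n => (hfin n).1)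
      (Eventually.of_forall fun x => by positivity) (Eventually.of_forall fun n => (hfin n).2)
  exact ⟨hint, le_of_tendsto (hcover.integral_tendsto_of_countably_generated hint)
    (Eventually.of_forall fun n => (hfin n).2)⟩

/-! ### Convexity and log-concavity of admissible functions -/

/-- A convex increasing function `s` on `[0, ∞)` with `s 0 = 0`, derivative `s'` and inverse `T`,
together with the two consequences of log-concavity that are needed: `s'` grows by a bounded
factor over unit distance, and `s` is almost affine on the pieces on which it increases by a
bounded amount. -/
structure ConvexProfile (s s' T : ℝ → ℝ) : Prop where
  map_zero : s 0 = 0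
  strictMonoOn : StrictMonoOn s (Ici 0)
  tangent : ∀ x y, 0 ≤ x → 0 < y → s y + s' y * (x - y) ≤ s x
  inv_nonneg : ∀ η, 0 ≤ η → 0 ≤ T η
  right_inv : ∀ η, 0 ≤ η → s (T η) = η
  deriv_growth : ∃ E Y, 1 ≤ E ∧ 0 < Y ∧ ∀ z y, Y ≤ z → z ≤ y → y ≤ z + 1 → s' y ≤ E * s' z
  almost_affine : ∀ r A, 0 < r → 0 < A → ∃ Y, 0 < Y ∧ ∀ y z, Y ≤ y → y ≤ z → s z - s y ≤ A →
    (1 - r) * (s z - s y) ≤ s' y * (z - y)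

namespace SubexponentiallyAdmissible

variable {S : ℝ → ℝ}

theorem differentiableAt (hS : SubexponentiallyAdmissible S) {t : ℝ} (ht : 0 < t) :
    DifferentiableAt ℝ S t :=
  ((hS.contDiffOn.differentiableOn (by norm_num)) t ht.le).differentiableAt (Ici_mem_nhds ht)

theorem tangent_le (hS : SubexponentiallyAdmissible S) {x y : ℝ} (hx : 0 ≤ x) (hy : 0 < y) :
    S y + deriv S y * (x - y) ≤ S x := by
  rcases lt_trichotomy x y with h | h | h
  · have h1 := hS.convexOn.slope_le_deriv (mem_Ici.2 hx) (mem_Ici.2 hy.le) h (hS.differentiableAt hy)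
    rw [slope_def_field, div_le_iff₀ (sub_pos.2 h)] at h1
    linarith
  · simp [h]
  · have h1 := hS.convexOn.deriv_le_slope (mem_Ici.2 hy.le) (mem_Ici.2 hx) h (hS.differentiableAt hy)
    rw [slope_def_field, le_div_iff₀ (sub_pos.2 h)] at h1
    linarith

theorem deriv_pos (hS : SubexponentiallyAdmissible S) {y : ℝ} (hy : 0 < y) : 0 < deriv S y := by
  have h1 := hS.tangent_le le_rfl hy
  have h2 := hS.strictMonoOn (mem_Ici.2 le_rfl) (mem_Ici.2 hy.le) hy
  by_contra h
  nlinarith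

theorem deriv_le_deriv (hS : SubexponentiallyAdmissible S) {x y : ℝ} (hx : 0 < x) (hxy : x ≤ y) :
    deriv S x ≤ deriv S y := by
  rcases hxy.eq_or_lt with rfl | h
  · rfl
  have h1 := hS.tangent_le (hx.le.trans hxy) hx
  have h2 := hS.tangent_le hx.le (hx.trans_le hxy)
  have h3 : deriv S x * (y - x) ≤ deriv S y * (y - x) := by linarith
  exact le_of_mul_le_mul_right h3 (sub_pos.2 h)

theorem pos (hS : SubexponentiallyAdmissible S) {y : ℝ} (hy : 0 < y) : 0 < S y :=
  (hS.nonneg 0 le_rfl).trans_lt (hS.strictMonoOn (mem_Ici.2 le_rfl) (mem_Ici.2 hy.le) hy)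

theorem deriv_sq (hS : SubexponentiallyAdmissible S) {y : ℝ} (hy : 0 < y) :
    deriv (fun t => S t ^ 2) y = 2 * S y * deriv S y := by
  have := ((hS.differentiableAt hy).hasDerivAt.fun_pow 2).deriv
  simpa using this

/-- Ratios of `S'` are bounded by ratios of `(S²)' = 2 S S'`. -/
theorem deriv_le_of_log_le (hS : SubexponentiallyAdmissible S) {y z e : ℝ} (hy : 0 < y)
    (hyz : y ≤ z) (h : Real.log (deriv (fun t => S t ^ 2) z) -
      Real.log (deriv (fun t => S t ^ 2) y) ≤ e) : deriv S z ≤ Real.exp e * deriv S y := by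
  have hz := hy.trans_le hyz
  rw [hS.deriv_sq hy, hS.deriv_sq hz] at h
  have p1 := hS.pos hy
  have p2 := hS.pos hz
  have p3 := hS.deriv_pos hy
  have p4 := hS.deriv_pos hz
  have hmono : S y ≤ S z := hS.strictMonoOn.monotoneOn (mem_Ici.2 hy.le) (mem_Ici.2 hz.le) hyz
  have h1 : 2 * S z * deriv S z ≤ Real.exp e * (2 * S y * deriv S y) := by
    rw [← Real.exp_log (show 0 < 2 * S z * deriv S z by positivity),
      ← Real.exp_log (show 0 < 2 * S y * deriv S y by positivity), ← Real.exp_add]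
    exact Real.exp_le_exp.2 (by linarith)
  have h2 : Real.exp e * (2 * S y * deriv S y) ≤ Real.exp e * (2 * S z * deriv S y) := by
    gcongr
  have h3 : 2 * S z * deriv S z ≤ 2 * S z * (Real.exp e * deriv S y) := by linarith
  exact le_of_mul_le_mul_left h3 (by positivity)

/-- The logarithm of `(S²)'` is concave, so its increments over unit distance are bounded. -/
theorem deriv_growth (hS : SubexponentiallyAdmissible S) :
    ∃ E Y, 1 ≤ E ∧ 0 < Y ∧ ∀ z y, Y ≤ z → z ≤ y → y ≤ z + 1 → deriv S y ≤ E * deriv S z := by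
  obtain ⟨T₀, hT₀, hlog⟩ := hS.logConcave
  set L : ℝ → ℝ := fun t => Real.log (deriv (fun t => S t ^ 2) t) with hL
  refine ⟨Real.exp (max (L (T₀ + 1) - L T₀) 0), T₀ + 1, Real.one_le_exp (le_max_right _ _),
    by linarith, fun z y hz hzy hyz => ?_⟩
  have hzpos : 0 < z := by linarith
  refine hS.deriv_le_of_log_le hzpos hzy ?_
  change L y - L z ≤ _
  rcases hzy.eq_or_lt with rfl | hlt
  · simp
  have h1 := hlog.concaveOn_log.slope_anti_adjacent (x := T₀) (y := z) (z := y) (mem_Ici.2 le_rfl)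
    (mem_Ici.2 (by linarith)) (by linarith) hlt
  have h2 : (L z - L T₀) / (z - T₀) ≤ L (T₀ + 1) - L T₀ := by
    rcases hz.eq_or_lt with h | h
    · rw [← h]; simp
    · have h3 := hlog.concaveOn_log.slope_anti_adjacent (x := T₀) (y := T₀ + 1) (z := z)
        (mem_Ici.2 le_rfl) (mem_Ici.2 (by linarith)) (by linarith) h
      change (L z - L (T₀ + 1)) / (z - (T₀ + 1)) ≤ (L (T₀ + 1) - L T₀) / (T₀ + 1 - T₀) at h3
      rw [add_sub_cancel_left, div_one, div_le_iff₀ (by linarith)] at h3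
      rw [div_le_iff₀ (by linarith)]
      linarith
  change (L y - L z) / (y - z) ≤ (L z - L T₀) / (z - T₀) at h1
  rw [div_le_iff₀ (sub_pos.2 hlt)] at h1
  calc L y - L z ≤ (L z - L T₀) / (z - T₀) * (y - z) := h1
    _ ≤ max (L (T₀ + 1) - L T₀) 0 * (y - z) :=
      mul_le_mul_of_nonneg_right (h2.trans (le_max_left _ _)) (sub_nonneg.2 hzy)
    _ ≤ max (L (T₀ + 1) - L T₀) 0 * 1 :=
      mul_le_mul_of_nonneg_left (by linarith) (le_max_right _ _)
    _ = _ := mul_one _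

/-- While `S` increases by at most `A`, its argument increases by at most `A / S'(y)`, and the
logarithmic slope of `(S²)'` at `y` is `o(S'(y))`; so `S'` hardly changes. -/
theorem almost_affine (hS : SubexponentiallyAdmissible S) {r A : ℝ} (hr : 0 < r) (hA : 0 < A) :
    ∃ Y, 0 < Y ∧ ∀ y z, Y ≤ y → y ≤ z → S z - S y ≤ A →
      (1 - r) * (S z - S y) ≤ deriv S y * (z - y) := by
  obtain ⟨T₀, hT₀, hlog⟩ := hS.logConcave
  set L : ℝ → ℝ := fun t => Real.log (deriv (fun t => S t ^ 2) t) with hL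
  set c := deriv S 1 with hc
  have hcpos : 0 < c := hS.deriv_pos one_pos
  have hS0 := hS.nonneg 0 le_rfl
  set K := 2 * (S 0 / c + 1) with hK
  have hKpos : 0 < K := by positivity
  -- `w` stands for `y S'(y)`, and `log (S²)'(y)` is at most `log K + 2 log w`
  have hw : ∀ᶠ w : ℝ in atTop, A * (Real.log K - L T₀ + 2 * Real.log w) ≤ r / 2 * w := by
    have h1 : (fun w : ℝ => A * (Real.log K - L T₀ + 2 * Real.log w)) =o[atTop] (id : ℝ → ℝ) := by
      refine Asymptotics.IsLittleO.const_mul_left ?_ A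
      exact (Asymptotics.isLittleO_const_id_atTop _).add
        (Real.isLittleO_log_id_atTop.const_mul_left 2)
    filter_upwards [h1.bound (half_pos hr), eventually_ge_atTop 0] with w hw hw0
    refine (le_abs_self _).trans ?_
    simpa [abs_of_nonneg hw0] using hw
  obtain ⟨W, hW⟩ := eventually_atTop.1 hw
  refine ⟨max (max 1 (2 * T₀)) (W / c), by positivity, fun y z hy hyz hzA => ?_⟩
  have hy1 : 1 ≤ y := (le_max_left _ _).trans ((le_max_left _ _).trans hy)
  have hy2 : 2 * T₀ ≤ y := (le_max_right _ _).trans ((le_max_left _ _).trans hy)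
  have hy3 : W / c ≤ y := (le_max_right _ _).trans hy
  have hy0 : 0 < y := by linarith
  have hz0 : 0 < z := by linarith
  have hcy : c ≤ deriv S y := hS.deriv_le_deriv one_pos hy1
  have hdy := hS.deriv_pos hy0
  set w := y * deriv S y with hwdef
  have hwW : W ≤ w := by
    rw [div_le_iff₀ hcpos] at hy3
    nlinarith
  have hcw : c ≤ w := by nlinarith
  have hwpos : 0 < w := by linarith
  have hLy : L y ≤ Real.log K + 2 * Real.log w := by
    have h1 : S y ≤ S 0 + w := by
      have := hS.tangent_le le_rfl hy0
      rw [hwdef]; linarith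
    have h2 : S 0 ≤ S 0 / c * w := by
      rw [div_mul_eq_mul_div, le_div_iff₀ hcpos]
      exact mul_le_mul_of_nonneg_left hcw hS0
    have h3 : deriv S y ≤ w := by rw [hwdef]; nlinarith
    have h4 : deriv (fun t => S t ^ 2) y ≤ K * w ^ 2 := by
      rw [hS.deriv_sq hy0]
      calc 2 * S y * deriv S y ≤ 2 * (S 0 / c * w + w) * w := by
            have := hS.pos hy0
            gcongr; linarith
        _ = K * w ^ 2 := by rw [hK]; ring
    have h5 : 0 < deriv (fun t => S t ^ 2) y := hlog.pos y (mem_Ici.2 (by linarith))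
    calc L y ≤ Real.log (K * w ^ 2) := Real.log_le_log h5 h4
      _ = Real.log K + 2 * Real.log w := by
        rw [Real.log_mul hKpos.ne' (by positivity), Real.log_pow]; norm_num
  have hyT : y / 2 ≤ y - T₀ := by linarith
  have hkey : A * (L y - L T₀) ≤ r * ((y - T₀) * deriv S y) := by
    have h1 := hW w hwW
    have h2 : A * (L y - L T₀) ≤ A * (Real.log K - L T₀ + 2 * Real.log w) :=
      mul_le_mul_of_nonneg_left (by linarith) hA.le
    have h3 : r * (y / 2 * deriv S y) ≤ r * ((y - T₀) * deriv S y) := by gcongr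
    have h4 : r / 2 * w = r * (y / 2 * deriv S y) := by rw [hwdef]; ring
    linarith
  rcases hyz.eq_or_lt with rfl | hlt
  · simp
  have hzy : z - y ≤ A / deriv S y := by
    rw [le_div_iff₀ hdy]
    have := hS.tangent_le hz0.le hy0
    linarith
  have hslope : L z - L y ≤ r := by
    have h1 := hlog.concaveOn_log.slope_anti_adjacent (x := T₀) (y := y) (z := z) (mem_Ici.2 le_rfl)
      (mem_Ici.2 (by linarith)) (by linarith) hlt
    change (L z - L y) / (z - y) ≤ (L y - L T₀) / (y - T₀) at h1
    rw [div_le_iff₀ (sub_pos.2 hlt)] at h1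
    have hT : 0 < y - T₀ := by linarith
    rcases le_total (L y - L T₀) 0 with h | h
    · have : (L y - L T₀) / (y - T₀) * (z - y) ≤ 0 :=
        mul_nonpos_of_nonpos_of_nonneg (div_nonpos_of_nonpos_of_nonneg h hT.le) (by linarith)
      linarith
    · calc L z - L y ≤ (L y - L T₀) / (y - T₀) * (z - y) := h1
        _ ≤ (L y - L T₀) / (y - T₀) * (A / deriv S y) :=
          mul_le_mul_of_nonneg_left hzy (by positivity)
        _ = A * (L y - L T₀) / ((y - T₀) * deriv S y) := by field_simp
        _ ≤ r := by rw [div_le_iff₀ (by positivity)]; exact hkey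
  have h1 := hS.deriv_le_of_log_le hy0 hyz hslope
  have h2 : S z - S y ≤ deriv S z * (z - y) := by
    have := hS.tangent_le hy0.le hz0
    linarith
  have h3 : S z - S y ≤ Real.exp r * (deriv S y * (z - y)) := by
    calc _ ≤ deriv S z * (z - y) := h2
      _ ≤ (Real.exp r * deriv S y) * (z - y) := by
        apply mul_le_mul_of_nonneg_right h1; linarith
      _ = _ := by ring
  have h4 : (1 - r) ≤ Real.exp (-r) := by linarith [Real.add_one_le_exp (-r)]
  have h5 : 0 ≤ S z - S y := sub_nonneg.2 (hS.strictMonoOn.monotoneOn hy0.le hz0.le hyz)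
  calc (1 - r) * (S z - S y) ≤ Real.exp (-r) * (Real.exp r * (deriv S y * (z - y))) :=
        mul_le_mul h4 h3 h5 (Real.exp_pos _).le
    _ = _ := by rw [← mul_assoc, ← Real.exp_add]; simp

theorem tendsto_self_atTop (hS : SubexponentiallyAdmissible S) : Tendsto S atTop atTop := by
  have h1 : Tendsto (fun x : ℝ => S 1 + deriv S 1 * (x - 1)) atTop atTop :=
    tendsto_atTop_add_const_left _ _ ((tendsto_atTop_add_const_right _ _ tendsto_id).const_mul_atTop
      (hS.deriv_pos one_pos))
  refine tendsto_atTop_mono' _ ?_ h1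
  filter_upwards [eventually_ge_atTop 0] with x hx
  exact hS.tangent_le hx one_pos

theorem increasingInverse_apply (hS : SubexponentiallyAdmissible S) {x : ℝ} (hx : 0 ≤ x) :
    increasingInverse S (S x) = x := by
  refine (IsLeast.csInf_eq ⟨⟨hx, le_rfl⟩, fun y hy => ?_⟩)
  exact (hS.strictMonoOn.le_iff_le hx hy.1).1 hy.2

theorem exists_eq (hS : SubexponentiallyAdmissible S) {y : ℝ} (hy : S 0 ≤ y) :
    ∃ x, 0 ≤ x ∧ S x = y := by
  obtain ⟨b, hb, hb0⟩ := ((hS.tendsto_self_atTop.eventually_ge_atTop y).and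
    (eventually_ge_atTop 0)).exists
  obtain ⟨x, hx, hxy⟩ := intermediate_value_Icc hb0
    (hS.contDiffOn.continuousOn.mono Icc_subset_Ici_self) ⟨hy, hb⟩
  exact ⟨x, hx.1, hxy⟩

theorem increasingInverse_mono (hS : SubexponentiallyAdmissible S) :
    Monotone (increasingInverse S) := by
  intro y z hyz
  refine csInf_le_csInf ⟨0, fun x hx => hx.1⟩ ?_ fun x hx => ⟨hx.1, hyz.trans hx.2⟩
  obtain ⟨x, hx⟩ := ((hS.tendsto_self_atTop.eventually_ge_atTop z).and
    (eventually_ge_atTop 0)).exists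
  exact ⟨x, hx.2, hx.1⟩

theorem increasingInverse_tendsto (hS : SubexponentiallyAdmissible S) :
    Tendsto (increasingInverse S) atTop atTop := by
  refine Filter.tendsto_atTop.2 fun b => ?_
  filter_upwards [eventually_ge_atTop (S (max b 0))] with y hy
  have := hS.increasingInverse_mono hy
  rw [hS.increasingInverse_apply (le_max_right _ _)] at this
  exact (le_max_left _ _).trans this

theorem convexProfile (hS : SubexponentiallyAdmissible S) :
    ConvexProfile (fun t => S t - S 0) (deriv S) (fun η => increasingInverse S (η + S 0)) where
  map_zero := sub_self _
  strictMonoOn := fun x hx y hy hxy => sub_lt_sub_right (hS.strictMonoOn hx hy hxy) _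
  tangent := fun x y hx hy => by linarith [hS.tangent_le hx hy]
  inv_nonneg := fun η _ => Real.sInf_nonneg fun x hx => hx.1
  right_inv := fun η hη => by
    obtain ⟨x, hx, hxy⟩ := hS.exists_eq (y := η + S 0) (by linarith)
    rw [← hxy, hS.increasingInverse_apply hx, hxy]; ring
  deriv_growth := hS.deriv_growth
  almost_affine := fun r A hr hA => by
    simpa only [sub_sub_sub_cancel_right] using hS.almost_affine hr hA

end SubexponentiallyAdmissible

namespace ConvexProfile

variable {s s' T : ℝ → ℝ}

theorem apply_pos (P : ConvexProfile s s' T) {x : ℝ} (hx : 0 < x) : 0 < s x := by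
  have := P.strictMonoOn (mem_Ici.2 le_rfl) (mem_Ici.2 hx.le) hx
  rwa [P.map_zero] at this

theorem apply_nonneg (P : ConvexProfile s s' T) {x : ℝ} (hx : 0 ≤ x) : 0 ≤ s x := by
  have := P.strictMonoOn.monotoneOn (mem_Ici.2 le_rfl) (mem_Ici.2 hx) hx
  rwa [P.map_zero] at this

theorem mono (P : ConvexProfile s s' T) {x y : ℝ} (hx : 0 ≤ x) (hxy : x ≤ y) : s x ≤ s y :=
  P.strictMonoOn.monotoneOn (mem_Ici.2 hx) (mem_Ici.2 (hx.trans hxy)) hxy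

theorem le_mul_deriv (P : ConvexProfile s s' T) {y : ℝ} (hy : 0 < y) : s y ≤ y * s' y := by
  have := P.tangent 0 y le_rfl hy
  rw [P.map_zero] at this
  linarith

theorem deriv_pos (P : ConvexProfile s s' T) {y : ℝ} (hy : 0 < y) : 0 < s' y := by
  have h1 := P.le_mul_deriv hy
  have h2 := P.apply_pos hy
  exact pos_of_mul_pos_right (h2.trans_le h1) hy.le

theorem deriv_mono (P : ConvexProfile s s' T) {x y : ℝ} (hx : 0 < x) (hxy : x ≤ y) :
    s' x ≤ s' y := by
  rcases hxy.eq_or_lt with rfl | h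
  · rfl
  have h1 := P.tangent y x (hx.le.trans hxy) hx
  have h2 := P.tangent x y hx.le (hx.trans_le hxy)
  have h3 : s' x * (y - x) ≤ s' y * (y - x) := by linarith
  exact le_of_mul_le_mul_right h3 (sub_pos.2 h)

/-- `s x / x` is increasing. -/
theorem mul_le_mul_of_le (P : ConvexProfile s s' T) {x y : ℝ} (hx : 0 ≤ x) (hxy : x ≤ y) :
    s x * y ≤ s y * x := by
  rcases hx.eq_or_lt with rfl | hx
  · simp [P.map_zero]
  have h1 := P.tangent y x (hx.le.trans hxy) hx
  have h2 := P.le_mul_deriv hx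
  nlinarith [mul_le_mul_of_nonneg_right h2 (sub_nonneg.2 hxy),
    mul_le_mul_of_nonneg_left h1 hx.le]

theorem superadditive (P : ConvexProfile s s' T) {x y : ℝ} (hx : 0 ≤ x) (hy : 0 ≤ y) :
    s x + s y ≤ s (x + y) := by
  rcases (add_nonneg hx hy).eq_or_lt with h | h
  · have h1 : x = 0 := by linarith
    have h2 : y = 0 := by linarith
    simp [h1, h2, P.map_zero]
  have h1 := P.mul_le_mul_of_le hx (le_add_of_nonneg_right hy)
  have h2 := P.mul_le_mul_of_le hy (le_add_of_nonneg_left hx)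
  refine le_of_mul_le_mul_right ?_ h
  linarith

theorem linear_le (P : ConvexProfile s s' T) {x : ℝ} (hx : 1 ≤ x) : s 1 * x ≤ s x := by
  simpa using P.mul_le_mul_of_le zero_le_one hx

theorem left_inv (P : ConvexProfile s s' T) {y : ℝ} (hy : 0 ≤ y) : T (s y) = y :=
  P.strictMonoOn.injOn (P.inv_nonneg _ (P.apply_nonneg hy)) hy (P.right_inv _ (P.apply_nonneg hy))

theorem inv_mono (P : ConvexProfile s s' T) {η ζ : ℝ} (hη : 0 ≤ η) (h : η ≤ ζ) : T η ≤ T ζ := by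
  rw [← P.strictMonoOn.le_iff_le (P.inv_nonneg _ hη) (P.inv_nonneg _ (hη.trans h)),
    P.right_inv _ hη, P.right_inv _ (hη.trans h)]
  exact h

theorem inv_pos (P : ConvexProfile s s' T) {η : ℝ} (hη : 0 < η) : 0 < T η := by
  rcases (P.inv_nonneg _ hη.le).eq_or_lt with h | h
  · have := P.right_inv _ hη.le
    rw [← h, P.map_zero] at this
    exact absurd this hη.ne
  · exact h

end ConvexProfile

/-! ### Tangent lines to the squared profile -/

theorem le_one_add_cube {u : ℝ} (hu : 0 ≤ u) : u ≤ 1 + u ^ 3 ∧ u ^ 2 ≤ 1 + u ^ 3 := by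
  constructor <;> nlinarith [mul_nonneg hu (sq_nonneg (u - 1)), sq_nonneg (u - 1)]

/-- The slope `d(s²)/d(t²)` at the point `t = T |η|` where `s = |η|`: the coefficient of the
tangent line to `s²` as a function of the squared argument. At `η = 0` the quotient is `0 / 0 = 0`, a
horizontal line through the origin. -/
noncomputable def tangentWeight (s' T : ℝ → ℝ) (η : ℝ) : ℝ :=
  s' (T |η|) * |η| / T |η|

namespace ConvexProfile

variable {s s' T : ℝ → ℝ}

theorem tangentWeight_nonneg (P : ConvexProfile s s' T) (η : ℝ) : 0 ≤ tangentWeight s' T η := by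
  rcases (abs_nonneg η).eq_or_lt with h | h
  · simp [tangentWeight, ← h]
  · have h1 := P.inv_pos h
    have h2 := P.deriv_pos h1
    unfold tangentWeight
    positivity

/-- As a function of the squared argument, `s²` is convex, hence lies above its tangents. -/
theorem tangentWeight_le (P : ConvexProfile s s' T) (x η : ℝ) :
    tangentWeight s' T η * (x ^ 2 - T |η| ^ 2) + η ^ 2 ≤ s |x| ^ 2 := by
  rcases (abs_nonneg η).eq_or_lt with h | h
  · have : η = 0 := abs_eq_zero.1 h.symm
    simp only [tangentWeight, this, abs_zero, mul_zero, zero_div, zero_mul, zero_add, ne_eq,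
      OfNat.ofNat_ne_zero, not_false_eq_true, zero_pow]
    positivity
  have hy := P.inv_pos h
  set y := T |η| with hyd
  have hs : s y = |η| := P.right_inv _ h.le
  have hd := P.deriv_pos hy
  have hx := abs_nonneg x
  rw [← sq_abs x, ← sq_abs η, tangentWeight, ← hyd, ← hs]
  set X := |x|
  have hsX := P.apply_nonneg hx
  have hsy := P.apply_pos hy
  suffices s' y * s y * (X ^ 2 - y ^ 2) ≤ (s X ^ 2 - s y ^ 2) * y by
    rw [div_mul_eq_mul_div, ← le_sub_iff_add_le, div_le_iff₀ hy]
    exact this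
  have ht := P.tangent X y hx hy
  rcases le_total y X with h1 | h1
  · have h2 := P.mul_le_mul_of_le hy.le h1
    have h3 := P.mono hy.le h1
    have h4 : s y * (X + y) ≤ (s X + s y) * y := by linarith
    calc s' y * s y * (X ^ 2 - y ^ 2) = (s' y * (X - y)) * (s y * (X + y)) := by ring
      _ ≤ (s X - s y) * ((s X + s y) * y) :=
        mul_le_mul (by linarith) h4 (by positivity) (by linarith)
      _ = _ := by ring
  · have h2 := P.mul_le_mul_of_le hx h1
    have h3 := P.mono hx h1
    have h4 : (s X + s y) * y ≤ s y * (X + y) := by linarith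
    have h5 : (s y - s X) * ((s X + s y) * y) ≤ (s' y * (y - X)) * (s y * (X + y)) :=
      mul_le_mul (by linarith) h4 (by positivity) (mul_nonneg hd.le (by linarith))
    linarith [h5]

/-- The linear extrapolation of `s` from `y` back to `z` exceeds the true increment by at most a
factor that is affine in the increment. -/
theorem deriv_mul_sub_le (P : ConvexProfile s s' T) {E Y : ℝ} (hE : 1 ≤ E) (hY : 0 < Y)
    (hg : ∀ z y, Y ≤ z → z ≤ y → y ≤ z + 1 → s' y ≤ E * s' z) {y z : ℝ} (hz : Y ≤ z)
    (hzy : z ≤ y) : s' y * (y - z) ≤ E * (s y - s z) * (1 + (s y - s z) / s 1) := by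
  have hz0 : 0 < z := hY.trans_le hz
  have h1 : 0 < s 1 := P.apply_pos one_pos
  have hδ : 0 ≤ s y - s z := sub_nonneg.2 (P.mono hz0.le hzy)
  rcases le_total y (z + 1) with h | h
  · have h2 := hg z y hz hzy h
    have h3 := P.tangent y z (hz0.le.trans hzy) hz0
    calc s' y * (y - z) ≤ E * s' z * (y - z) :=
          mul_le_mul_of_nonneg_right h2 (sub_nonneg.2 hzy)
      _ = E * (s' z * (y - z)) := by ring
      _ ≤ E * (s y - s z) := by gcongr; linarith
      _ ≤ _ := by
        apply le_mul_of_one_le_right (by positivity)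
        have : 0 ≤ (s y - s z) / s 1 := by positivity
        linarith
  · have h2 := hg (y - 1) y (by linarith) (by linarith) (by linarith)
    have h3 := P.tangent y (y - 1) (by linarith) (by linarith)
    have h4 := P.mono hz0.le (show z ≤ y - 1 by linarith)
    have h5 := P.linear_le (show 1 ≤ y - z by linarith)
    have h6 := P.superadditive hz0.le (show 0 ≤ y - z by linarith)
    rw [add_sub_cancel] at h6
    have h7 : y - z ≤ (s y - s z) / s 1 := by rw [le_div_iff₀ h1]; linarith
    calc s' y * (y - z) ≤ (E * (s y - s z)) * ((s y - s z) / s 1) := by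
          apply mul_le_mul _ h7 (by linarith) (by positivity)
          refine h2.trans (mul_le_mul_of_nonneg_left ?_ (by positivity))
          linarith
      _ ≤ _ := by
        apply mul_le_mul_of_nonneg_left _ (by positivity)
        linarith

set_option maxHeartbeats 400000 in
/-- At frequencies `ξ` outside a bounded set the tangent line at `η`, evaluated at the shifted
point `T (|ξ| + A)`, exceeds `ξ²` by a multiple of `A |ξ|`, up to an error that grows
polynomially in `|ξ - η|` and does not depend on `A`. -/
theorem le_tangentWeight (P : ConvexProfile s s' T) : ∃ C, 0 < C ∧ ∀ A, 1 ≤ A → ∃ R, ∀ ξ η,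
    R ≤ |ξ| → ξ ^ 2 + A / 2 * |ξ| - C * |ξ| * (1 + |ξ - η| ^ 3) ≤
      tangentWeight s' T η * (T (|ξ| + A) ^ 2 - T |η| ^ 2) + η ^ 2 := by
  obtain ⟨E, Y, hE, hY, hg⟩ := P.deriv_growth
  have hs1 : 0 < s 1 := P.apply_pos one_pos
  set K := E * (1 + 1 / s 1) with hK
  have hKpos : 0 < K := by positivity
  refine ⟨8 * K + 3, by positivity, fun A hA => ?_⟩
  obtain ⟨Y', hY', hg'⟩ := P.almost_affine (1 / 6) (2 * A) (by norm_num) (by linarith)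
  refine ⟨max (s Y) (s Y' + A), fun ξ η hξ => ?_⟩
  have hX1 : s Y ≤ |ξ| := (le_max_left _ _).trans hξ
  have hX2 : s Y' + A ≤ |ξ| := (le_max_right _ _).trans hξ
  have hsY' := P.apply_nonneg hY'.le
  have huX : |ξ| - |η| ≤ |ξ - η| := abs_sub_abs_le_abs_sub _ _
  have huH : |η| - |ξ| ≤ |ξ - η| := by rw [abs_sub_comm]; exact abs_sub_abs_le_abs_sub _ _
  rw [← sq_abs ξ, ← sq_abs η]
  unfold tangentWeight
  have hH0 := abs_nonneg η
  have hu0 := abs_nonneg (ξ - η)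
  set X := |ξ|
  set H := |η|
  set u := |ξ - η|
  have hX0 : A ≤ X := by linarith
  have hcub := le_one_add_cube hu0
  set z := T (X + A) with hz
  have hsz : s z = X + A := P.right_inv _ (by linarith)
  rcases hH0.eq_or_lt with hH | hH
  · -- here `η = 0`, the tangent line degenerates, and `|ξ - η| ≥ |ξ|`
    rw [← hH]
    have h1 : X ≤ u := by linarith
    simp only [mul_zero, zero_div, zero_mul]
    have h2 : X * X ≤ X * u := mul_le_mul_of_nonneg_left h1 (by linarith)
    have h3 : A / 2 * X ≤ X * u := by
      rw [mul_comm]; exact mul_le_mul_of_nonneg_left (by linarith) (by linarith)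
    have h4 : X * u ≤ X * (1 + u ^ 3) := mul_le_mul_of_nonneg_left hcub.1 (by linarith)
    have h5 : 0 ≤ K * X * (1 + u ^ 3) := by positivity
    have h6 : 0 ≤ X * (1 + u ^ 3) := by positivity
    linarith
  have hy : 0 < T H := P.inv_pos hH
  set y := T H with hyd
  have hsy : s y = H := P.right_inv _ hH.le
  have hd := P.deriv_pos hy
  have hfrac : s' y * H / y * (z ^ 2 - y ^ 2) = H * (s' y * (z - y)) * ((z + y) / y) := by
    field_simp; ring
  rw [hfrac]
  rcases le_total H (X + A) with hHX | hHX
  · have hyz : y ≤ z := P.inv_mono hH.le hHX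
    have h2 : 2 ≤ (z + y) / y := by rw [le_div_iff₀ hy]; linarith
    have h3 : 0 ≤ H * (s' y * (z - y)) :=
      mul_nonneg hH.le (mul_nonneg hd.le (sub_nonneg.2 hyz))
    rcases le_total u (A / 2) with hu | hu
    -- near the diagonal `s` is almost affine between `y` and `z`, and the margin is gained
    · have hYy : Y' ≤ y := by
        rw [← P.left_inv hY'.le]
        exact P.inv_mono hsY' (by linarith)
      have h4 := hg' y z hYy hyz (by rw [hsz, hsy]; linarith)
      rw [hsz, hsy] at h4
      have h5 : H * ((1 - 1 / 6) * (X + A - H)) * 2 ≤ H * (s' y * (z - y)) * ((z + y) / y) :=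
        mul_le_mul (mul_le_mul_of_nonneg_left h4 hH.le) h2 (by norm_num) h3
      have h6 : 0 ≤ (8 * K + 3) * X * (1 + u ^ 3) := by positivity
      set w := X - H with hw
      have hw1 : w ≤ A / 2 := by linarith
      have hw2 : -(A / 2) ≤ w := by linarith
      have hHw : H = X - w := by rw [hw]; ring
      rw [hHw] at h5 ⊢
      have hw3 : w ^ 2 ≤ (A / 2) ^ 2 := sq_le_sq' hw2 hw1
      have h7 : 0 ≤ X * (A / 2 - w) := mul_nonneg (by linarith) (by linarith)
      have h8 : A * A ≤ A * X := mul_le_mul_of_nonneg_left hX0 (by linarith)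
      have h9 : A * w ≤ A * (A / 2) := mul_le_mul_of_nonneg_left hw1 (by linarith)
      linarith
    -- away from the diagonal the claimed gain is smaller than the error
    · have h4 : 0 ≤ H * (s' y * (z - y)) * ((z + y) / y) := mul_nonneg h3 (by linarith)
      have h5 : A / 2 * X ≤ X * (1 + u ^ 3) := by
        rw [mul_comm]; exact mul_le_mul_of_nonneg_left (hu.trans hcub.1) (by linarith)
      have h6 : X * (X - H) ≤ X * (1 + u ^ 3) :=
        mul_le_mul_of_nonneg_left (huX.trans hcub.1) (by linarith)
      have h7 : 0 ≤ K * X * (1 + u ^ 3) := by positivity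
      linarith [sq_nonneg (X - H)]
  -- here the tangent point lies beyond `z`, and the tangent line has dropped below `s²`
  · have hzpos : 0 < z := P.inv_pos (by linarith)
    have hzy : z ≤ y := P.inv_mono (by linarith) hHX
    have hYz : Y ≤ z := by
      rw [← P.left_inv hY.le]
      exact P.inv_mono (P.apply_nonneg hY.le) (by linarith)
    have h1 := P.deriv_mul_sub_le hE hY hg hYz hzy
    rw [hsz, hsy] at h1
    set δ := H - (X + A) with hδ
    have hδ0 : 0 ≤ δ := by linarith
    have hδu : δ ≤ u := by linarith
    have h2 : (z + y) / y ≤ 2 := by rw [div_le_iff₀ hy]; linarith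
    have h3 : s' y * (y - z) ≤ K * (u * (1 + u)) := by
      refine h1.trans ?_
      calc E * δ * (1 + δ / s 1) ≤ E * u * (1 + u / s 1) := by gcongr
        _ ≤ E * u * ((1 + 1 / s 1) * (1 + u)) := by
          gcongr
          have e1 : (0:ℝ) ≤ 1 / s 1 := by positivity
          have e2 : u / s 1 = u * (1 / s 1) := by ring
          linarith
        _ = _ := by rw [hK]; ring
    have h4 : H ≤ X * (1 + u) := by
      have : u ≤ X * u := le_mul_of_one_le_left hu0 (by linarith)
      linarith
    have h5 : H * (s' y * (y - z)) * ((z + y) / y) ≤ X * (1 + u) * (K * (u * (1 + u))) * 2 := by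
      have e1 : 0 ≤ s' y * (y - z) := mul_nonneg hd.le (sub_nonneg.2 hzy)
      have e2 : 0 ≤ (z + y) / y := by positivity
      gcongr
    have h6 : u * (1 + u) ^ 2 ≤ 4 * (1 + u ^ 3) := by
      have : 0 ≤ u ^ 3 := by positivity
      linarith [hcub.1, hcub.2]
    have h7 : X * (1 + u) * (K * (u * (1 + u))) * 2 ≤ 8 * K * X * (1 + u ^ 3) := by
      calc _ = 2 * K * X * (u * (1 + u) ^ 2) := by ring
        _ ≤ 2 * K * X * (4 * (1 + u ^ 3)) := by gcongr
        _ = _ := by ring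
    have h8 : H * (s' y * (z - y)) * ((z + y) / y) = -(H * (s' y * (y - z)) * ((z + y) / y)) := by
      ring
    have h9 : A / 2 * X ≤ X * (1 + u ^ 3) := by
      rw [mul_comm]
      refine mul_le_mul_of_nonneg_left ?_ (by linarith)
      have : A ≤ u := by linarith
      linarith [hcub.1]
    have h10 : X ^ 2 ≤ H ^ 2 := pow_le_pow_left₀ (by linarith) (by linarith) 2
    have h11 : 0 ≤ X * (1 + u ^ 3) := by positivity
    rw [h8]
    linarith

/-- The amount by which the tangent line at `η` drops down to the origin grows at most cubically
in `η`. -/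
theorem tangentWeight_mul_sq_le (P : ConvexProfile s s' T) : ∃ C, 0 < C ∧ ∀ η,
    tangentWeight s' T η * T |η| ^ 2 ≤ C * (1 + |η|) ^ 3 := by
  obtain ⟨E, Y, hE, hY, hg⟩ := P.deriv_growth
  have hs1 : 0 < s 1 := P.apply_pos one_pos
  have hD := P.deriv_pos (show 0 < Y + 1 by linarith)
  refine ⟨(s' (Y + 1) + E) * (1 + 1 / s 1), by positivity, fun η => ?_⟩
  have hH0 := abs_nonneg η
  unfold tangentWeight
  set H := |η|
  rcases hH0.eq_or_lt with hH | hH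
  · rw [← hH]; simp; positivity
  have hy : 0 < T H := P.inv_pos hH
  set y := T H with hyd
  have hsy : s y = H := P.right_inv _ hH.le
  have hd := P.deriv_pos hy
  have h1 : s' y ≤ (s' (Y + 1) + E) * (1 + H) := by
    rcases le_total y (Y + 1) with h | h
    · calc s' y ≤ s' (Y + 1) := P.deriv_mono hy h
        _ ≤ _ := by nlinarith
    · have h2 := hg (y - 1) y (by linarith) (by linarith) (by linarith)
      have h3 := P.tangent y (y - 1) (by linarith) (by linarith)
      have h4 := P.apply_nonneg (show 0 ≤ y - 1 by linarith)
      have h5 : s' (y - 1) ≤ H := by linarith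
      nlinarith [mul_le_mul_of_nonneg_left h5 (show 0 ≤ E by linarith)]
  have h2 : y ≤ (1 + 1 / s 1) * (1 + H) := by
    have e1 : 0 ≤ 1 / s 1 := by positivity
    rcases le_total y 1 with h | h
    · nlinarith
    · have h3 := P.linear_le h
      have h4 : y ≤ H * (1 / s 1) := by rw [mul_one_div, le_div_iff₀ hs1]; linarith
      nlinarith
  calc s' y * H / y * y ^ 2 = s' y * H * y := by field_simp
    _ ≤ ((s' (Y + 1) + E) * (1 + H)) * (1 + H) * ((1 + 1 / s 1) * (1 + H)) := by
      gcongr; linarith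
    _ = _ := by ring

end ConvexProfile

/-! ### The windowed Fourier transform -/

/-- A smooth window `k` supported in `[-1, 1]`, with `‖k‖₂ = 1`; its Fourier transform has finite
moments. -/
theorem exists_window : ∃ k : ℝ → ℂ, Continuous k ∧ (∀ x, 1 < |x| → k x = 0) ∧
    ∫ x, ‖k x‖ ^ 2 = 1 ∧ Integrable (fun u : ℝ => (1 + |u| ^ 3) * ‖𝓕 k u‖ ^ 2) := by
  let b : ContDiffBump (0 : ℝ) := ⟨1 / 2, 1, by norm_num, by norm_num⟩
  have hbsupp : ∀ x, 1 < |x| → b x = 0 := by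
    intro x hx
    apply b.zero_of_le_dist
    rw [Real.dist_eq, sub_zero]; exact hx.le
  have hbc : HasCompactSupport (fun x => (b x : ℂ)) :=
    b.hasCompactSupport.comp_left (g := fun y : ℝ => (y : ℂ)) (by simp)
  have hbs : ContDiff ℝ (⊤ : ℕ∞) (fun x => (b x : ℂ)) :=
    Complex.ofRealCLM.contDiff.comp b.contDiff
  set G : SchwartzMap ℝ ℂ := hbc.toSchwartzMap hbs with hG
  have hGx : ∀ x, G x = (b x : ℂ) := fun x => rfl
  set c := ∫ x, ‖G x‖ ^ 2 with hc
  have hcpos : 0 < c := by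
    refine integral_pos_of_integrable_nonneg_nonzero (x := 0) (by fun_prop) ?_
      (fun x => by positivity) ?_
    · exact (memLp_two_iff_integrable_sq_norm G.continuous.aestronglyMeasurable).1 (G.memLp 2)
    · have : b 0 = 1 := b.one_of_mem_closedBall (by simp; norm_num [b])
      simp [hGx, this]
  set K : SchwartzMap ℝ ℂ := ((Real.sqrt c)⁻¹ : ℂ) • G with hK
  have hKx : ∀ x, ‖K x‖ ^ 2 = c⁻¹ * ‖G x‖ ^ 2 := by
    intro x
    have : K x = ((Real.sqrt c)⁻¹ : ℂ) * G x := rfl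
    rw [this, norm_mul, mul_pow, norm_inv, Complex.norm_real, inv_pow, Real.norm_eq_abs, sq_abs,
      Real.sq_sqrt hcpos.le]
  refine ⟨K, K.continuous, fun x hx => ?_, ?_, ?_⟩
  · have : K x = ((Real.sqrt c)⁻¹ : ℂ) * G x := rfl
    rw [this, hGx, hbsupp x hx]; simp
  · simp_rw [hKx]
    rw [integral_const_mul, ← hc, inv_mul_cancel₀ hcpos.ne']
  · rw [← SchwartzMap.fourier_coe]
    set Q : SchwartzMap ℝ ℂ := 𝓕 K with hQ
    obtain ⟨D, hD⟩ := Q.decay 0 0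
    have hD' : ∀ x, ‖Q x‖ ≤ D := fun x => by simpa using hD.2 x
    have h0 : Integrable fun x => D * ‖Q x‖ := Q.integrable.norm.const_mul D
    have h3 : Integrable fun x : ℝ => D * (‖x‖ ^ 3 * ‖Q x‖) :=
      (Q.integrable_pow_mul volume 3).const_mul D
    refine (h0.add h3).mono' (by fun_prop) (Eventually.of_forall fun x => ?_)
    rw [Real.norm_of_nonneg (by positivity), Pi.add_apply, Real.norm_eq_abs x]
    have : (1 + |x| ^ 3) * ‖Q x‖ ^ 2 ≤ (1 + |x| ^ 3) * (D * ‖Q x‖) := by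
      rw [sq]
      have := hD' x
      gcongr
    linarith

/-- The short-time Fourier transform of `f` with window `k` at frequency `η`, normalized so that
it is the convolution of `f` with the modulated window. -/
noncomputable def windowed (k f : ℝ → ℂ) (η x : ℝ) : ℂ :=
  Real.fourierChar (η * x) • 𝓕 (fun t => f t * k (x - t)) η

section Windowed

variable {k f : ℝ → ℂ}

theorem windowed_eq_convolution (η : ℝ) : windowed k f η =
    convolution f (fun x => Real.fourierChar (η * x) • k x) (ContinuousLinearMap.mul ℂ ℂ)
      volume := by
  ext x
  rw [windowed, Real.fourier_eq, convolution, Circle.smul_def, ← integral_smul]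
  refine integral_congr_ae (Eventually.of_forall fun t => ?_)
  simp only [ContinuousLinearMap.mul_apply', Circle.smul_def, smul_eq_mul]
  have h : Real.fourierChar (η * (x - t)) =
      Real.fourierChar (η * x) * Real.fourierChar (-inner ℝ t η) := by
    rw [← AddChar.map_add_eq_mul]
    congr 1
    simp only [RCLike.inner_apply, conj_trivial]
    ring
  rw [h]
  push_cast
  ring

theorem hasCompactSupport_window (hk0 : ∀ x, 1 < |x| → k x = 0) : HasCompactSupport k := by
  refine HasCompactSupport.intro (isCompact_Icc (a := (-1 : ℝ)) (b := 1)) fun x hx => hk0 x ?_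
  by_contra h
  exact hx (abs_le.1 (not_lt.1 h))

theorem integrable_window (hk : Continuous k) (hk0 : ∀ x, 1 < |x| → k x = 0) : Integrable k :=
  hk.integrable_of_hasCompactSupport (hasCompactSupport_window hk0)

theorem exists_bound_window (hk : Continuous k) (hk0 : ∀ x, 1 < |x| → k x = 0) :
    ∃ D, 0 ≤ D ∧ ∀ x, ‖k x‖ ≤ D := by
  obtain ⟨D, hD⟩ := hk.bounded_above_of_compact_support (hasCompactSupport_window hk0)
  exact ⟨D, (norm_nonneg _).trans (hD 0), hD⟩

theorem integrable_modulated (hk : Continuous k) (hk0 : ∀ x, 1 < |x| → k x = 0) (η : ℝ) :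
    Integrable fun x => Real.fourierChar (η * x) • k x := by
  refine (integrable_window hk hk0).norm.mono' ?_ (Eventually.of_forall fun x => ?_)
  · exact (((Real.continuous_fourierChar.comp (continuous_const.mul continuous_id)).smul
      hk)).aestronglyMeasurable
  · rw [Circle.norm_smul]

theorem integrable_windowed (hk : Continuous k) (hk0 : ∀ x, 1 < |x| → k x = 0)
    (hf : Integrable f) (η : ℝ) : Integrable (windowed k f η) := by
  rw [windowed_eq_convolution]
  exact hf.integrable_convolution _ (integrable_modulated hk hk0 η)

theorem fourier_windowed (hk : Continuous k) (hk0 : ∀ x, 1 < |x| → k x = 0)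
    (hf : Integrable f) (η ξ : ℝ) : 𝓕 (windowed k f η) ξ = 𝓕 k (ξ - η) * 𝓕 f ξ := by
  rw [windowed_eq_convolution, Real.fourier_mul_convolution_eq hf (integrable_modulated hk hk0 η),
    mul_comm]
  congr 1
  rw [Real.fourier_eq, Real.fourier_eq]
  refine integral_congr_ae (Eventually.of_forall fun x => ?_)
  simp only [smul_smul]
  congr 1
  rw [← AddChar.map_add_eq_mul]
  congr 1
  simp only [RCLike.inner_apply, conj_trivial]
  ring

theorem norm_windowed (η x : ℝ) :
    ‖windowed k f η x‖ = ‖𝓕 (fun t => f t * k (x - t)) η‖ := by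
  rw [windowed, Circle.norm_smul]

theorem continuous_windowed (hk : Continuous k) (hk0 : ∀ x, 1 < |x| → k x = 0)
    (hfc : Continuous f) (hf : Integrable f) :
    Continuous fun p : ℝ × ℝ => windowed k f p.2 p.1 := by
  obtain ⟨D, hD0, hD⟩ := exists_bound_window hk hk0
  unfold windowed
  refine (Real.continuous_fourierChar.comp (by fun_prop)).smul ?_
  simp only [Real.fourier_eq]
  refine continuous_of_dominated (bound := fun t => D * ‖f t‖) (fun p => ?_) (fun p => ?_)
    (hf.norm.const_mul D) (Eventually.of_forall fun t => ?_)
  · exact ((Real.continuous_fourierChar.comp (by fun_prop)).smul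
      (by fun_prop)).aestronglyMeasurable
  · refine Eventually.of_forall fun t => ?_
    rw [Circle.norm_smul, norm_mul, mul_comm]
    exact mul_le_mul_of_nonneg_right (hD _) (norm_nonneg _)
  · exact (Real.continuous_fourierChar.comp (by fun_prop)).smul (by fun_prop)

/-- Plancherel's theorem in the frequency variable. -/
theorem integral_norm_sq_windowed (hk : Continuous k) (hk0 : ∀ x, 1 < |x| → k x = 0)
    (hfc : Continuous f) (hf : Integrable f) (hf2 : MemLp f 2) (x : ℝ) :
    Integrable (fun η => ‖windowed k f η x‖ ^ 2) ∧
      ∫ η, ‖windowed k f η x‖ ^ 2 = ∫ t, ‖f t‖ ^ 2 * ‖k (x - t)‖ ^ 2 := by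
  obtain ⟨D, hD0, hD⟩ := exists_bound_window hk hk0
  have hle : ∀ t, ‖f t * k (x - t)‖ ≤ D * ‖f t‖ := fun t => by
    rw [norm_mul, mul_comm]
    exact mul_le_mul_of_nonneg_right (hD _) (norm_nonneg _)
  have hc : Continuous fun t => f t * k (x - t) := by fun_prop
  have h1 : Integrable fun t => f t * k (x - t) :=
    (hf.norm.const_mul D).mono' hc.aestronglyMeasurable (Eventually.of_forall hle)
  have h2 : MemLp (fun t => f t * k (x - t)) 2 :=
    hf2.of_le_mul (c := D) hc.aestronglyMeasurable (Eventually.of_forall hle)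
  simp_rw [norm_windowed]
  refine ⟨(memLp_two_iff_integrable_sq_norm
    (continuous_fourier_of_integrable h1).aestronglyMeasurable).1 (memLp_fourier h1 h2), ?_⟩
  rw [integral_norm_sq_fourier h1 h2]
  simp_rw [norm_mul, mul_pow]

theorem integrable_norm_sq_window (hk : Continuous k) (hk0 : ∀ x, 1 < |x| → k x = 0) :
    Integrable fun x => ‖k x‖ ^ 2 := by
  refine Continuous.integrable_of_hasCompactSupport (by fun_prop) ?_
  exact (hasCompactSupport_window hk0).comp_left (g := fun z : ℂ => ‖z‖ ^ 2) (by simp)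

/-- Integration over all frequencies turns a weight in `x` into the same weight on `f`, up to a
shift by the width of the window. -/
theorem integral_weight_windowed_le (hk : Continuous k) (hk0 : ∀ x, 1 < |x| → k x = 0)
    (hk1 : ∫ x, ‖k x‖ ^ 2 = 1) (hfc : Continuous f) (hf : Integrable f) (hf2 : MemLp f 2)
    {σ ρ : ℝ → ℝ} (hσm : Measurable σ) (hσ0 : ∀ x, 0 ≤ σ x)
    (hσρ : ∀ x t, |x - t| ≤ 1 → σ x ≤ ρ t) (hρ : Integrable fun t => ρ t * ‖f t‖ ^ 2) :
    Integrable (fun p : ℝ × ℝ => σ p.2 * ‖windowed k f p.1 p.2‖ ^ 2) (volume.prod volume) ∧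
      ∫ η, ∫ x, σ x * ‖windowed k f η x‖ ^ 2 ≤ ∫ t, ρ t * ‖f t‖ ^ 2 := by
  have hk2 := integrable_norm_sq_window hk hk0
  have hf2' : Integrable fun t => ‖f t‖ ^ 2 :=
    (memLp_two_iff_integrable_sq_norm hf2.aestronglyMeasurable).1 hf2
  have c1 := hf2'.convolution_integrand (ContinuousLinearMap.mul ℝ ℝ) hk2
  have c2 := hρ.convolution_integrand (ContinuousLinearMap.mul ℝ ℝ) hk2
  simp only [ContinuousLinearMap.mul_apply'] at c1 c2
  have hpt : ∀ x t, σ x * (‖f t‖ ^ 2 * ‖k (x - t)‖ ^ 2) ≤ ρ t * ‖f t‖ ^ 2 * ‖k (x - t)‖ ^ 2 := by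
    intro x t
    rcases le_or_gt |x - t| 1 with h | h
    · have := hσρ x t h
      rw [← mul_assoc]
      gcongr
    · simp [hk0 _ h]
  have hle : ∀ᵐ x, σ x * ∫ t, ‖f t‖ ^ 2 * ‖k (x - t)‖ ^ 2 ≤
      ∫ t, ρ t * ‖f t‖ ^ 2 * ‖k (x - t)‖ ^ 2 := by
    filter_upwards [c2.prod_right_ae] with x hx2
    rw [← integral_const_mul]
    refine integral_mono_of_nonneg (Eventually.of_forall fun t => ?_) hx2
      (Eventually.of_forall fun t => hpt x t)
    have := hσ0 x
    positivity
  have hm : AEStronglyMeasurable (fun p : ℝ × ℝ => σ p.1 * ‖windowed k f p.2 p.1‖ ^ 2)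
      (volume.prod volume) :=
    ((hσm.comp measurable_fst).mul
      ((continuous_windowed hk hk0 hfc hf).norm.pow 2).measurable).aestronglyMeasurable
  have hval : ∀ x, ∫ η, σ x * ‖windowed k f η x‖ ^ 2 =
      σ x * ∫ t, ‖f t‖ ^ 2 * ‖k (x - t)‖ ^ 2 := fun x => by
    rw [integral_const_mul, (integral_norm_sq_windowed hk hk0 hfc hf hf2 x).2]
  have hint : Integrable fun x => σ x * ∫ t, ‖f t‖ ^ 2 * ‖k (x - t)‖ ^ 2 := by
    refine c2.integral_prod_left.mono' (hσm.aestronglyMeasurable.mul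
      c1.integral_prod_left.aestronglyMeasurable) ?_
    filter_upwards [hle] with x hx
    rw [Real.norm_of_nonneg]
    · exact hx
    · exact mul_nonneg (hσ0 x) (integral_nonneg fun t => by positivity)
  have hI : Integrable (fun p : ℝ × ℝ => σ p.1 * ‖windowed k f p.2 p.1‖ ^ 2)
      (volume.prod volume) := by
    rw [integrable_prod_iff hm]
    refine ⟨Eventually.of_forall fun x =>
      ((integral_norm_sq_windowed hk hk0 hfc hf hf2 x).1.const_mul (σ x)), hint.congr
      (Eventually.of_forall fun x => ?_)⟩
    dsimp only
    rw [← hval]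
    refine integral_congr_ae (Eventually.of_forall fun η => ?_)
    dsimp only
    rw [Real.norm_of_nonneg (mul_nonneg (hσ0 x) (by positivity))]
  refine ⟨hI.swap, ?_⟩
  rw [← integral_integral_swap (f := fun x η => σ x * ‖windowed k f η x‖ ^ 2) hI]
  simp_rw [hval]
  calc _ ≤ ∫ x, ∫ t, ρ t * ‖f t‖ ^ 2 * ‖k (x - t)‖ ^ 2 := integral_mono_ae hint
        c2.integral_prod_left hle
    _ = ∫ t, ρ t * ‖f t‖ ^ 2 := by
      have := integral_convolution (ContinuousLinearMap.mul ℝ ℝ) hρ hk2 (μ := volume)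
      simp only [convolution, ContinuousLinearMap.mul_apply', hk1, mul_one] at this
      exact this

end Windowed

/-! ### The phase-space inequality -/

theorem integrable_mul_norm_sq_of_le {u : ℝ → ℂ} (hu : Continuous u)
    (hi : Integrable fun x : ℝ => (1 + x ^ 2) * ‖u x‖ ^ 2) {w : ℝ → ℝ} (hw : Measurable w) {D : ℝ}
    (hD : ∀ x, |w x| ≤ D * (1 + x ^ 2)) : Integrable fun x => w x * ‖u x‖ ^ 2 := by
  refine (hi.const_mul D).mono' (hw.aestronglyMeasurable.mul
    (hu.norm.pow 2).aestronglyMeasurable) (Eventually.of_forall fun x => ?_)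
  rw [norm_mul, Real.norm_eq_abs, norm_pow, norm_norm, ← mul_assoc]
  exact mul_le_mul_of_nonneg_right (hD x) (by positivity)

namespace MemFourierSobolev

variable {f : ℝ → ℂ}

theorem integrable_norm_sq (hf : MemFourierSobolev f) : Integrable fun x => ‖f x‖ ^ 2 :=
  (memLp_two_iff_integrable_sq_norm hf.memLp.aestronglyMeasurable).1 hf.memLp

theorem integrable_fourier_norm_sq (hf : MemFourierSobolev f) :
    Integrable fun ξ => ‖𝓕 f ξ‖ ^ 2 :=
  (memLp_two_iff_integrable_sq_norm hf.continuous_fourier.aestronglyMeasurable).1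
    (memLp_fourier hf.integrable hf.memLp)

theorem integrable_fourier (hf : MemFourierSobolev f) : Integrable (𝓕 f) := by
  refine (integrable_inv_one_add_sq.add hf.integrable_fourier_weight).mono'
    hf.continuous_fourier.aestronglyMeasurable (Eventually.of_forall fun x => ?_)
  have h1 : 0 < 1 + x ^ 2 := by positivity
  have h4 : 0 ≤ (1 + x ^ 2)⁻¹ * ((1 + x ^ 2) * ‖𝓕 f x‖ - 1) ^ 2 := by positivity
  have h5 : (1 + x ^ 2)⁻¹ * ((1 + x ^ 2) * ‖𝓕 f x‖ - 1) ^ 2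
      = (1 + x ^ 2) * ‖𝓕 f x‖ ^ 2 - 2 * ‖𝓕 f x‖ + (1 + x ^ 2)⁻¹ := by
    field_simp
    ring
  have h6 := norm_nonneg (𝓕 f x)
  simp only [Pi.add_apply]
  linarith

theorem fourier_fourier_neg (hf : MemFourierSobolev f) : 𝓕 (fun x => 𝓕 f (-x)) = f := by
  rw [← Real.fourierInv_eq_fourier_comp_neg]
  exact hf.continuous.fourierInv_fourier_eq hf.integrable hf.integrable_fourier

theorem integrable_of_le (hf : MemFourierSobolev f) {w : ℝ → ℝ} (hw : Measurable w) {D : ℝ}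
    (hD : ∀ x, |w x| ≤ D * (1 + x ^ 2)) : Integrable fun x => w x * ‖f x‖ ^ 2 :=
  integrable_mul_norm_sq_of_le hf.continuous hf.integrable_weight hw hD

theorem integrable_fourier_of_le (hf : MemFourierSobolev f) {w : ℝ → ℝ} (hw : Measurable w)
    {D : ℝ} (hD : ∀ x, |w x| ≤ D * (1 + x ^ 2)) : Integrable fun x => w x * ‖𝓕 f x‖ ^ 2 :=
  integrable_mul_norm_sq_of_le hf.continuous_fourier hf.integrable_fourier_weight hw hD

end MemFourierSobolev

theorem integral_mul_comp_sub {u w : ℝ → ℝ} (hu : Integrable u) (hw : Integrable w) :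
    Integrable (fun p : ℝ × ℝ => u p.2 * w (p.2 - p.1)) (volume.prod volume) ∧
      ∫ η, ∫ ξ, u ξ * w (ξ - η) = (∫ ξ, u ξ) * ∫ x, w x := by
  have h1 := hu.convolution_integrand (ContinuousLinearMap.mul ℝ ℝ) hw.comp_neg
  have h2 := integral_convolution (ContinuousLinearMap.mul ℝ ℝ) hu hw.comp_neg (μ := volume)
  simp only [convolution, ContinuousLinearMap.mul_apply', neg_sub] at h1 h2
  rw [integral_neg_eq_self w] at h2
  exact ⟨h1, h2⟩

/-- The tangent inequality `v(η) (x² - T(|η|)²) + η² ≤ s(|x|)²`, tested against the phase-space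
density of `f`, followed by Wirtinger's inequality for each frequency-localized piece of `f` (whose
Fourier transform vanishes wherever that of `f` does). -/
theorem ConvexProfile.integral_symbol_le {s s' T : ℝ → ℝ} (P : ConvexProfile s s' T)
    (hsc : Continuous fun x => s |x|)
    {k : ℝ → ℂ} (hk : Continuous k) (hk0 : ∀ x, 1 < |x| → k x = 0)
    (hk1 : ∫ x, ‖k x‖ ^ 2 = 1) (hkm : Integrable fun u : ℝ => (1 + |u| ^ 3) * ‖𝓕 k u‖ ^ 2)
    {f : ℝ → ℂ} (hf : MemFourierSobolev f)
    (hρ : Integrable fun t => s (|t| + 1) ^ 2 * ‖f t‖ ^ 2)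
    {mu : ℤ → ℝ} (hmu : IsOrderedSequence mu) (hz : ∀ j, 𝓕 f (mu j) = 0)
    {τ : ℝ → ℝ} (hτm : Measurable τ) (hτ0 : ∀ x, 0 ≤ τ x)
    (hτ : ∀ j, ∀ x ∈ Icc (mu j) (mu (j + 1)), τ x * (mu (j + 1) - mu j) ≤ 1 / 2)
    {α β : ℝ → ℝ} (hα : Measurable α) (hβ : Measurable β) {D : ℝ}
    (hαD : ∀ ξ, |α ξ| ≤ D * (1 + ξ ^ 2)) (hβD : ∀ ξ, |β ξ| ≤ D * (1 + ξ ^ 2))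
    (hB : ∀ ξ η, α ξ - β ξ * (1 + |ξ - η| ^ 3) ≤
      tangentWeight s' T η * (τ ξ ^ 2 - T |η| ^ 2) + η ^ 2) :
    ∫ ξ, (α ξ - β ξ * ∫ u, (1 + |u| ^ 3) * ‖𝓕 k u‖ ^ 2) * ‖𝓕 f ξ‖ ^ 2 ≤
      ∫ t, s (|t| + 1) ^ 2 * ‖f t‖ ^ 2 := by
  have hfi := hf.integrable
  have hfc := hf.continuous
  have hFc := hf.continuous_fourier
  have hkc := continuous_fourier_of_integrable (integrable_window hk hk0)
  -- the weights `s(|x|)²`, `x²` and `1` are integrable over phase space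
  obtain ⟨i1, l1⟩ := integral_weight_windowed_le hk hk0 hk1 hfc hfi hf.memLp
    (σ := fun x => s |x| ^ 2) (ρ := fun t => s (|t| + 1) ^ 2) (hsc.measurable.pow_const 2)
    (fun x => by positivity) (fun x t hxt => by
      have h1 : |x| ≤ |t| + 1 := by
        have := abs_sub_abs_le_abs_sub x t
        linarith
      exact pow_le_pow_left₀ (P.apply_nonneg (abs_nonneg x)) (P.mono (abs_nonneg x) h1) 2) hρ
  obtain ⟨i2, -⟩ := integral_weight_windowed_le hk hk0 hk1 hfc hfi hf.memLp
    (σ := fun x => x ^ 2) (ρ := fun t => 3 * (1 + t ^ 2)) (by fun_prop)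
    (fun x => by positivity) (fun x t hxt => by
      have h1 : (x - t) ^ 2 ≤ 1 := (sq_le_one_iff_abs_le_one _).2 hxt
      nlinarith [sq_nonneg (x - 2 * t)]) (by
        simpa only [mul_assoc] using hf.integrable_weight.const_mul 3)
  obtain ⟨i3, -⟩ := integral_weight_windowed_le hk hk0 hk1 hfc hfi hf.memLp
    (σ := fun x => 1) (ρ := fun t => 1) (by fun_prop)
    (fun x => by positivity) (fun x t hxt => le_rfl) (by
        simpa using hf.integrable_norm_sq)
  -- integrability of the lower bound over phase space
  have jα := hf.integrable_fourier_of_le hα hαD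
  have jβ := hf.integrable_fourier_of_le hβ hβD
  have hw2 : Integrable fun u : ℝ => ‖𝓕 k u‖ ^ 2 := by
    refine hkm.mono' (hkc.norm.pow 2).aestronglyMeasurable (Eventually.of_forall fun u => ?_)
    rw [Real.norm_of_nonneg (by positivity)]
    apply le_mul_of_one_le_left (by positivity)
    have : 0 ≤ |u| ^ 3 := by positivity
    linarith
  have hw21 : ∫ u : ℝ, ‖𝓕 k u‖ ^ 2 = 1 := by
    rw [integral_norm_sq_fourier (integrable_window hk hk0)
      ((memLp_two_iff_integrable_sq_norm hk.aestronglyMeasurable).2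
        (integrable_norm_sq_window hk hk0)), hk1]
  obtain ⟨ja, ea⟩ := integral_mul_comp_sub jα hw2
  obtain ⟨jb, eb⟩ := integral_mul_comp_sub jβ hkm
  have hlow : ∫ η, ∫ ξ, (α ξ * ‖𝓕 f ξ‖ ^ 2 * ‖𝓕 k (ξ - η)‖ ^ 2 -
      β ξ * ‖𝓕 f ξ‖ ^ 2 * ((1 + |ξ - η| ^ 3) * ‖𝓕 k (ξ - η)‖ ^ 2)) =
      ∫ ξ, (α ξ - β ξ * ∫ u, (1 + |u| ^ 3) * ‖𝓕 k u‖ ^ 2) * ‖𝓕 f ξ‖ ^ 2 := by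
    have h1 := integral_integral_sub (μ := volume) (ν := volume)
      (f := fun p : ℝ × ℝ => α p.2 * ‖𝓕 f p.2‖ ^ 2 * ‖𝓕 k (p.2 - p.1)‖ ^ 2)
      (g := fun p : ℝ × ℝ =>
        β p.2 * ‖𝓕 f p.2‖ ^ 2 * ((1 + |p.2 - p.1| ^ 3) * ‖𝓕 k (p.2 - p.1)‖ ^ 2)) ja jb
    refine h1.trans ?_
    rw [ea, eb, hw21, mul_one, ← integral_mul_const,
      ← integral_sub jα (jβ.mul_const _)]
    refine integral_congr_ae (Eventually.of_forall fun ξ => ?_)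
    dsimp only
    ring
  rw [← hlow]
  refine le_trans ?_ l1
  refine integral_mono_ae (ja.sub jb).integral_prod_left i1.integral_prod_left ?_
  filter_upwards [ja.prod_right_ae, jb.prod_right_ae, i1.prod_right_ae, i2.prod_right_ae,
    i3.prod_right_ae] with η ka kb k1 k2 k3
  simp only [one_mul] at k3
  set φ := windowed k f η with hφ
  have iφ : Integrable φ := integrable_windowed hk hk0 hfi η
  have Fφ : ∀ ξ, ‖𝓕 φ ξ‖ ^ 2 = ‖𝓕 k (ξ - η)‖ ^ 2 * ‖𝓕 f ξ‖ ^ 2 := fun ξ => by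
    rw [hφ, fourier_windowed hk hk0 hfi, norm_mul, mul_pow]
  have mφ : MemLp φ 2 := (memLp_two_iff_integrable_sq_norm iφ.aestronglyMeasurable).2 k3
  obtain ⟨w1, w2⟩ := wirtinger_fourier iφ k2 hmu
    (fun j => by rw [hφ, fourier_windowed hk hk0 hfi, hz, mul_zero]) hτm hτ0 hτ
  have w3 := integral_norm_sq_fourier iφ mφ
  have w4 : Integrable fun ξ => ‖𝓕 φ ξ‖ ^ 2 :=
    (memLp_two_iff_integrable_sq_norm
      (continuous_fourier_of_integrable iφ).aestronglyMeasurable).1 (memLp_fourier iφ mφ)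
  set v := tangentWeight s' T η with hv
  have hv0 : 0 ≤ v := P.tangentWeight_nonneg η
  calc ∫ ξ, (α ξ * ‖𝓕 f ξ‖ ^ 2 * ‖𝓕 k (ξ - η)‖ ^ 2 -
      β ξ * ‖𝓕 f ξ‖ ^ 2 * ((1 + |ξ - η| ^ 3) * ‖𝓕 k (ξ - η)‖ ^ 2))
      ≤ ∫ ξ, (v * (τ ξ ^ 2 * ‖𝓕 φ ξ‖ ^ 2) + (η ^ 2 - v * T |η| ^ 2) * ‖𝓕 φ ξ‖ ^ 2) := by
        refine integral_mono (ka.sub kb) ((w1.const_mul v).add (w4.const_mul _)) fun ξ => ?_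
        dsimp only
        rw [Fφ]
        have h1 := mul_le_mul_of_nonneg_right (hB ξ η)
          (show 0 ≤ ‖𝓕 k (ξ - η)‖ ^ 2 * ‖𝓕 f ξ‖ ^ 2 by positivity)
        linarith
    _ = v * (∫ ξ, τ ξ ^ 2 * ‖𝓕 φ ξ‖ ^ 2) + (η ^ 2 - v * T |η| ^ 2) * ∫ x, ‖φ x‖ ^ 2 := by
        rw [integral_add (w1.const_mul v) (w4.const_mul _), integral_const_mul,
          integral_const_mul, w3]
    _ ≤ v * (∫ x, x ^ 2 * ‖φ x‖ ^ 2) + (η ^ 2 - v * T |η| ^ 2) * ∫ x, ‖φ x‖ ^ 2 := by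
        linarith [mul_le_mul_of_nonneg_left w2 hv0]
    _ = ∫ x, (v * (x ^ 2 * ‖φ x‖ ^ 2) + (η ^ 2 - v * T |η| ^ 2) * ‖φ x‖ ^ 2) := by
        rw [integral_add (k2.const_mul v) (k3.const_mul _), integral_const_mul,
          integral_const_mul]
    _ ≤ ∫ x, s |x| ^ 2 * ‖φ x‖ ^ 2 := by
        refine integral_mono ((k2.const_mul v).add (k3.const_mul _)) k1 fun x => ?_
        dsimp only
        have h1 := mul_le_mul_of_nonneg_right (P.tangentWeight_le x η)
          (show 0 ≤ ‖φ x‖ ^ 2 by positivity)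
        linarith

/-! ### The coercive estimate -/

/-- The gap condition with the margin `ν → ∞` gives, far out, the gap condition at the points of
the gap themselves with an arbitrary constant margin. -/
theorem exists_gap_bound {W ν : ℝ → ℝ} (hW : MonotoneOn W (Ici 0)) (hWt : Tendsto W atTop atTop)
    (hν : Tendsto ν atTop atTop) {a : ℤ → ℝ} (ha : IsOrderedSequence a) {N : ℕ}
    (hgap : ∀ j : ℤ, (N : ℤ) ≤ |j| → W (|a j| + ν |a j|) * (a (j + 1) - a j) ≤ 1 / 2)
    {A : ℝ} (hA : 0 ≤ A) :
    ∃ R, ∀ j, ∀ x ∈ Icc (a j) (a (j + 1)), R < |x| → W (|x| + A) * (a (j + 1) - a j) ≤ 1 / 2 := by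
  obtain ⟨t, ht⟩ := eventually_atTop.1 ((hν.eventually_ge_atTop (A + 1)).and
    (hWt.eventually_ge_atTop (1 / 2)))
  obtain ⟨j₁, hj₁⟩ := eventually_atTop.1 (ha.tendsto_atTop.eventually_ge_atTop t)
  obtain ⟨j₂, hj₂⟩ := eventually_atBot.1 (ha.tendsto_atBot.eventually_le_atBot (-t))
  set J : ℤ := max (max j₁ (-j₂)) N with hJ
  have hJ1 : j₁ ≤ J := (le_max_left _ _).trans (le_max_left _ _)
  have hJ2 : -j₂ ≤ J := (le_max_right _ _).trans (le_max_left _ _)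
  have hJ3 : (N : ℤ) ≤ J := le_max_right _ _
  refine ⟨max |a (-J)| |a J|, fun j x hx hRx => ?_⟩
  have hpos : 0 < a (j + 1) - a j := sub_pos.2 (ha.strictMono (lt_add_one j))
  have hj : J ≤ |j| := by
    by_contra h
    obtain ⟨h1, h2⟩ := abs_lt.1 (not_le.1 h)
    have h3 : a (-J) ≤ x := (ha.strictMono.monotone h1.le).trans hx.1
    have h4 : x ≤ a J := hx.2.trans (ha.strictMono.monotone (by omega))
    exact absurd hRx (not_lt.2 (abs_le_max_abs_abs h3 h4))
  have hta : t ≤ |a j| := by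
    rcases le_abs.1 hj with h | h
    · exact (hj₁ j (hJ1.trans h)).trans (le_abs_self _)
    · have := hj₂ j (by omega)
      exact (by linarith : t ≤ -a j).trans (neg_le_abs _)
  have hν1 : A + 1 ≤ ν |a j| := (ht _ hta).1
  have hW1 : 1 / 2 ≤ W (|a j| + ν |a j|) := (ht _ (by linarith)).2
  have hg := hgap j (hJ3.trans hj)
  have hle1 : a (j + 1) - a j ≤ 1 := by nlinarith
  have hx1 : |x| ≤ |a j| + 1 := by
    have h1 : |x - a j| ≤ 1 := by
      rw [abs_of_nonneg (sub_nonneg.2 hx.1)]; linarith [hx.2]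
    have := abs_sub_abs_le_abs_sub x (a j)
    linarith
  refine le_trans (mul_le_mul_of_nonneg_right (hW ?_ ?_ ?_) hpos.le) hg
  · exact mem_Ici.2 (by positivity)
  · exact mem_Ici.2 (by linarith [abs_nonneg (a j)])
  · linarith

theorem abs_le_one_add_sq (x : ℝ) : |x| ≤ 1 + x ^ 2 := by
  rw [← sq_abs]; nlinarith [sq_nonneg (|x| - 1)]

/-- Wirtinger's inequality on the side of `f`, which is the Fourier transform of `x ↦ 𝓕 f (-x)`. The
gap condition is assumed only for `|x| > R`; the bounded remainder costs a multiple of `‖f‖²`. -/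
theorem integral_weight_le {w : ℝ → ℝ} (hwc : Continuous w) (hw0 : ∀ x, 0 ≤ w x)
    {lam : ℤ → ℝ} (hlam : IsOrderedSequence lam) {R : ℝ}
    (hR : ∀ j, ∀ x ∈ Icc (lam j) (lam (j + 1)), R < |x| → w x * (lam (j + 1) - lam j) ≤ 1 / 2) :
    ∃ C, 0 ≤ C ∧ ∀ f, MemFourierSobolev f → (∀ j, f (lam j) = 0) →
      Integrable (fun x => w x ^ 2 * ‖f x‖ ^ 2) ∧
      ∫ x, w x ^ 2 * ‖f x‖ ^ 2 ≤ (∫ ξ, ξ ^ 2 * ‖𝓕 f ξ‖ ^ 2) + C * ∫ x, ‖f x‖ ^ 2 := by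
  obtain ⟨D, hD⟩ := (isCompact_Icc (a := -R) (b := R)).exists_bound_of_continuousOn
    hwc.continuousOn
  have hbd : ∀ x, |x| ≤ R → w x ^ 2 ≤ D ^ 2 := fun x hx => by
    have := hD x (abs_le.1 hx)
    rw [Real.norm_of_nonneg (hw0 x)] at this
    exact pow_le_pow_left₀ (hw0 x) this 2
  refine ⟨D ^ 2, by positivity, fun f hf hz => ?_⟩
  set q : ℝ → ℝ := fun x => if R < |x| then w x else 0 with hq
  have hqm : Measurable q := Measurable.ite (measurableSet_lt measurable_const (by fun_prop))
    hwc.measurable measurable_const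
  have iφ : Integrable fun x => 𝓕 f (-x) := hf.integrable_fourier.comp_neg
  have iφ2 : Integrable fun x : ℝ => x ^ 2 * ‖𝓕 f x‖ ^ 2 :=
    hf.integrable_fourier_of_le (D := 1) (by fun_prop) fun x => by
      rw [abs_of_nonneg (by positivity)]; linarith
  have iφ3 : Integrable fun x : ℝ => x ^ 2 * ‖𝓕 f (-x)‖ ^ 2 := by
    simpa using iφ2.comp_neg
  obtain ⟨h1, h2⟩ := wirtinger_fourier iφ iφ3 hlam
    (fun j => by rw [hf.fourier_fourier_neg]; exact hz j) hqm
    (fun x => by simp only [hq]; split_ifs; exacts [hw0 x, le_rfl])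
    (fun j x hx => by
      simp only [hq]
      split_ifs with h
      · exact hR j x hx h
      · norm_num)
  rw [hf.fourier_fourier_neg] at h1 h2
  have h3 : ∫ x : ℝ, x ^ 2 * ‖𝓕 f (-x)‖ ^ 2 = ∫ ξ, ξ ^ 2 * ‖𝓕 f ξ‖ ^ 2 := by
    have := integral_neg_eq_self (fun x : ℝ => x ^ 2 * ‖𝓕 f x‖ ^ 2) volume
    simpa using this
  rw [h3] at h2
  have hpt : ∀ x, w x ^ 2 * ‖f x‖ ^ 2 ≤ q x ^ 2 * ‖f x‖ ^ 2 + D ^ 2 * ‖f x‖ ^ 2 := fun x => by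
    simp only [hq]
    split_ifs with h
    · linarith [show 0 ≤ D ^ 2 * ‖f x‖ ^ 2 by positivity]
    · have := mul_le_mul_of_nonneg_right (hbd x (not_lt.1 h)) (sq_nonneg ‖f x‖)
      linarith [show (0 : ℝ) ^ 2 * ‖f x‖ ^ 2 = 0 by simp]
  have h4 := hf.integrable_norm_sq
  have h5 : Integrable fun x => w x ^ 2 * ‖f x‖ ^ 2 :=
    (h1.add (h4.const_mul (D ^ 2))).mono' ((hwc.pow 2).mul
      (hf.continuous.norm.pow 2)).aestronglyMeasurable (Eventually.of_forall fun x => by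
        rw [Real.norm_of_nonneg (by positivity)]; exact hpt x)
  refine ⟨h5, ?_⟩
  have h6 := integral_mono h5 (h1.add (h4.const_mul (D ^ 2))) hpt
  simp only [Pi.add_apply] at h6
  rw [integral_add h1 (h4.const_mul (D ^ 2)), integral_const_mul] at h6
  linarith

/-- The coercive estimate: functions in the vanishing space are concentrated, uniformly, in a
bounded region of phase space. -/
theorem exists_coercive_estimate {S : ℝ → ℝ} (hS : SubexponentiallyAdmissible S)
    {ν : ℝ → ℝ} (hν : Tendsto ν atTop atTop)
    {lam mu : ℤ → ℝ} (hlam : IsOrderedSequence lam) (hmu : IsOrderedSequence mu) {N : ℕ}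
    (hlam_gap : ∀ j : ℤ, (N : ℤ) ≤ |j| →
      S (|lam j| + ν |lam j|) * (lam (j + 1) - lam j) ≤ 1 / 2)
    (hmu_gap : ∀ j : ℤ, (N : ℤ) ≤ |j| →
      increasingInverse S (|mu j| + ν |mu j|) * (mu (j + 1) - mu j) ≤ 1 / 2) :
    ∃ c C, 0 < c ∧ 0 ≤ C ∧ ∀ f, MemFourierSobolev f → (∀ j, f (lam j) = 0) →
      (∀ j, 𝓕 f (mu j) = 0) →
      c * (∫ x, |x| * ‖f x‖ ^ 2) + ∫ ξ, |ξ| * ‖𝓕 f ξ‖ ^ 2 ≤ C * ∫ x, ‖f x‖ ^ 2 := by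
  have P := hS.convexProfile
  have hS0 := hS.nonneg 0 le_rfl
  set s : ℝ → ℝ := fun t => S t - S 0 with hs
  set T : ℝ → ℝ := fun η => increasingInverse S (η + S 0) with hT
  have hSc : ∀ a : ℝ, 0 ≤ a → Continuous fun x => s (|x| + a) := fun a ha =>
    (hS.contDiffOn.continuousOn.comp_continuous (by fun_prop)
      fun x => mem_Ici.2 (by positivity)).sub continuous_const
  have hsc : Continuous fun x => s |x| := by simpa using hSc 0 le_rfl
  obtain ⟨k, hk, hk0, hk1, hkm⟩ := exists_window
  set M := ∫ u : ℝ, (1 + |u| ^ 3) * ‖𝓕 k u‖ ^ 2 with hM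
  have hM0 : 0 ≤ M := integral_nonneg fun u => by positivity
  obtain ⟨C₁, hC₁, hlow⟩ := P.le_tangentWeight
  -- the margin is chosen so that the gain `A / 2` beats the localization error `C₁ M`
  set A := 2 * (C₁ * M + 1) with hAdef
  have hCM : 0 ≤ C₁ * M := by positivity
  have hA : 2 ≤ A := by linarith
  obtain ⟨R₁, hR₁⟩ := hlow A (by linarith)
  obtain ⟨R₂, hR₂⟩ := exists_gap_bound (hS.increasingInverse_mono.monotoneOn _)
    hS.increasingInverse_tendsto hν hmu hmu_gap (A := A + S 0) (by linarith)
  obtain ⟨R₃, hR₃⟩ := exists_gap_bound hS.strictMonoOn.monotoneOn hS.tendsto_self_atTop hν hlam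
    hlam_gap (A := A) (by linarith)
  obtain ⟨C₃, hC₃, hlamW⟩ := integral_weight_le (hSc A (by linarith))
    (fun x => P.apply_nonneg (by positivity)) hlam (R := R₃) (fun j x hx hRx => by
      refine le_trans (mul_le_mul_of_nonneg_right ?_
        (sub_nonneg.2 (hlam.strictMono.monotone (by omega)))) (hR₃ j x hx hRx)
      simp only [hs]; linarith)
  obtain ⟨Cp, hCp, hTp⟩ := P.tangentWeight_mul_sq_le
  set R := max (max R₁ R₂) 0 with hR
  have hRR1 : R₁ ≤ R := (le_max_left _ _).trans (le_max_left _ _)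
  have hRR2 : R₂ ≤ R := (le_max_right _ _).trans (le_max_left _ _)
  have hRR0 : 0 ≤ R := le_max_right _ _
  set C₂ := 4 * Cp * (1 + R) ^ 3 with hC₂
  have hC₂0 : 0 ≤ C₂ := by positivity
  -- `α - β (1 + |ξ - η|³)` is the lower bound for the tangent line at `η`; for `|ξ| ≤ R`, where no
  -- gap condition is available, the weight `τ` is set to zero
  set τ : ℝ → ℝ := fun ξ => if R < |ξ| then T (|ξ| + A) else 0 with hτ
  set α : ℝ → ℝ := fun ξ => if R < |ξ| then ξ ^ 2 + A / 2 * |ξ| else 0 with hα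
  set β : ℝ → ℝ := fun ξ => if R < |ξ| then C₁ * |ξ| else C₂ with hβ
  have hset : MeasurableSet {ξ : ℝ | R < |ξ|} := measurableSet_lt measurable_const (by fun_prop)
  have hτm : Measurable τ := Measurable.ite hset
    (hS.increasingInverse_mono.measurable.comp (by fun_prop)) measurable_const
  have hαm : Measurable α := Measurable.ite hset (by fun_prop) measurable_const
  have hβm : Measurable β := Measurable.ite hset (by fun_prop) measurable_const
  have hτ0 : ∀ x, 0 ≤ τ x := fun x => by
    simp only [hτ]
    split_ifs
    exacts [P.inv_nonneg _ (by positivity), le_rfl]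
  have hτgap : ∀ j, ∀ x ∈ Icc (mu j) (mu (j + 1)), τ x * (mu (j + 1) - mu j) ≤ 1 / 2 := by
    intro j x hx
    simp only [hτ]
    split_ifs with h
    · have := hR₂ j x hx (hRR2.trans_lt h)
      rw [← add_assoc] at this
      exact this
    · norm_num
  have hαD : ∀ ξ, |α ξ| ≤ (1 + A + C₁ + C₂) * (1 + ξ ^ 2) := fun ξ => by
    have h1 := abs_le_one_add_sq ξ
    have h2 := sq_nonneg ξ
    simp only [hα]
    split_ifs
    · rw [abs_of_nonneg (by positivity)]
      have h3 : A / 2 * |ξ| ≤ A / 2 * (1 + ξ ^ 2) := by gcongr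
      have h4 : 0 ≤ (A / 2 + C₁ + C₂) * (1 + ξ ^ 2) := by positivity
      linarith
    · rw [abs_zero]; positivity
  have hβD : ∀ ξ, |β ξ| ≤ (1 + A + C₁ + C₂) * (1 + ξ ^ 2) := fun ξ => by
    have h1 := abs_le_one_add_sq ξ
    have h2 := sq_nonneg ξ
    simp only [hβ]
    split_ifs
    · rw [abs_of_nonneg (by positivity)]
      calc C₁ * |ξ| ≤ C₁ * (1 + ξ ^ 2) := by gcongr
        _ ≤ _ := by gcongr; linarith
    · rw [abs_of_nonneg hC₂0]
      calc C₂ = C₂ * 1 := (mul_one _).symm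
        _ ≤ _ := by gcongr <;> linarith
  have hB : ∀ ξ η, α ξ - β ξ * (1 + |ξ - η| ^ 3) ≤
      tangentWeight (deriv S) T η * (τ ξ ^ 2 - T |η| ^ 2) + η ^ 2 := by
    intro ξ η
    simp only [hα, hβ, hτ]
    split_ifs with h
    · exact hR₁ ξ η (hRR1.trans h.le)
    · have h1 := hTp η
      have h2 : |η| ≤ R + |ξ - η| := by
        have := abs_sub_abs_le_abs_sub η ξ
        rw [abs_sub_comm η ξ] at this
        linarith [not_lt.1 h]
      set u := |ξ - η|
      have hu : 0 ≤ u := abs_nonneg _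
      have h4 : Cp * (1 + |η|) ^ 3 ≤ C₂ * (1 + u ^ 3) := by
        calc Cp * (1 + |η|) ^ 3 ≤ Cp * ((1 + R) * (1 + u)) ^ 3 := by
              gcongr
              linarith [mul_nonneg hRR0 hu]
          _ = Cp * (1 + R) ^ 3 * (1 + u) ^ 3 := by ring
          _ ≤ Cp * (1 + R) ^ 3 * (4 * (1 + u ^ 3)) := by
              gcongr
              nlinarith [mul_nonneg hu (sq_nonneg (u - 1)), sq_nonneg (u - 1)]
          _ = _ := by rw [hC₂]; ring
      linarith [sq_nonneg η]
  have hs1 : 0 < s 1 := P.apply_pos one_pos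
  refine ⟨s 1 ^ 2, C₃ + (R ^ 2 + R + C₂ * M), by positivity, by positivity, fun f hf hfl hfm => ?_⟩
  obtain ⟨iA, lA⟩ := hlamW f hf hfl
  have ix : Integrable fun x => |x| * ‖f x‖ ^ 2 :=
    hf.integrable_of_le (D := 1) (by fun_prop) fun x => by
      rw [abs_abs, one_mul]; exact abs_le_one_add_sq x
  have hpt : ∀ x, s (|x| + 1) ^ 2 * ‖f x‖ ^ 2 + s 1 ^ 2 * (|x| * ‖f x‖ ^ 2) ≤
      s (|x| + A) ^ 2 * ‖f x‖ ^ 2 := by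
    intro x
    have hx := abs_nonneg x
    have h1 : s (|x| + 1) + s 1 ≤ s (|x| + A) :=
      (P.superadditive (by positivity) zero_le_one).trans (P.mono (by positivity) (by linarith))
    have h2 : s 1 * (|x| + 1) ≤ s (|x| + 1) := P.linear_le (by linarith)
    have h3 : (s (|x| + 1) + s 1) ^ 2 ≤ s (|x| + A) ^ 2 :=
      pow_le_pow_left₀ (add_nonneg (P.apply_nonneg (by positivity)) hs1.le) h1 2
    have h4 : s 1 * (s 1 * (|x| + 1)) ≤ s 1 * s (|x| + 1) := by gcongr
    have h5 : s (|x| + 1) ^ 2 + s 1 ^ 2 * |x| ≤ s (|x| + A) ^ 2 := by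
      nlinarith [mul_nonneg hx (sq_nonneg (s 1))]
    nlinarith [mul_le_mul_of_nonneg_right h5 (sq_nonneg ‖f x‖)]
  have iρ : Integrable fun x => s (|x| + 1) ^ 2 * ‖f x‖ ^ 2 :=
    iA.mono' (((hSc 1 zero_le_one).pow 2).mul (hf.continuous.norm.pow 2)).aestronglyMeasurable
      (Eventually.of_forall fun x => by
        rw [Real.norm_of_nonneg (by positivity)]
        exact le_trans (le_add_of_nonneg_right (by positivity)) (hpt x))
  have hmain := P.integral_symbol_le hsc hk hk0 hk1 hkm hf iρ hmu hfm hτm hτ0 hτgap hαm hβm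
    hαD hβD hB
  rw [← hM] at hmain
  have hx2 := integral_mono (iρ.add (ix.const_mul (s 1 ^ 2))) iA hpt
  simp only [Pi.add_apply] at hx2
  rw [integral_add iρ (ix.const_mul (s 1 ^ 2)), integral_const_mul] at hx2
  have iξ2 : Integrable fun ξ : ℝ => ξ ^ 2 * ‖𝓕 f ξ‖ ^ 2 :=
    hf.integrable_fourier_of_le (D := 1) (by fun_prop) fun x => by
      rw [abs_of_nonneg (by positivity)]; linarith
  have iξ1 : Integrable fun ξ => |ξ| * ‖𝓕 f ξ‖ ^ 2 :=
    hf.integrable_fourier_of_le (D := 1) (by fun_prop) fun x => by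
      rw [abs_abs, one_mul]; exact abs_le_one_add_sq x
  have iξ0 := hf.integrable_fourier_norm_sq
  have hlower : (∫ ξ, ξ ^ 2 * ‖𝓕 f ξ‖ ^ 2) + (∫ ξ, |ξ| * ‖𝓕 f ξ‖ ^ 2) -
      (R ^ 2 + R + C₂ * M) * ∫ ξ, ‖𝓕 f ξ‖ ^ 2 ≤
      ∫ ξ, (α ξ - β ξ * M) * ‖𝓕 f ξ‖ ^ 2 := by
    have i21 : Integrable fun ξ : ℝ => ξ ^ 2 * ‖𝓕 f ξ‖ ^ 2 + |ξ| * ‖𝓕 f ξ‖ ^ 2 := iξ2.add iξ1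
    rw [← integral_add iξ2 iξ1, ← integral_const_mul, ← integral_sub i21 (iξ0.const_mul _)]
    have iαβ : Integrable fun ξ => (α ξ - β ξ * M) * ‖𝓕 f ξ‖ ^ 2 := by
      have := (hf.integrable_fourier_of_le hαm hαD).sub
        ((hf.integrable_fourier_of_le hβm hβD).mul_const M)
      refine this.congr (Eventually.of_forall fun ξ => ?_)
      simp only [Pi.sub_apply]; ring
    refine integral_mono (i21.sub (iξ0.const_mul _)) iαβ fun ξ => ?_
    have hξ := abs_nonneg ξ
    have h1 : ξ ^ 2 + |ξ| - (R ^ 2 + R + C₂ * M) ≤ α ξ - β ξ * M := by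
      simp only [hα, hβ]
      split_ifs with h
      · have h2 : A / 2 = C₁ * M + 1 := by rw [hAdef]; ring
        rw [h2]
        have : 0 ≤ R ^ 2 + R + C₂ * M := by positivity
        linarith
      · have h2 := not_lt.1 h
        have h3 : ξ ^ 2 ≤ R ^ 2 := by
          rw [← sq_abs]; exact pow_le_pow_left₀ hξ h2 2
        linarith
    have h2 := mul_le_mul_of_nonneg_right h1 (sq_nonneg ‖𝓕 f ξ‖)
    linarith
  rw [integral_norm_sq_fourier hf.integrable hf.memLp] at hlower
  linarith

/-! ### Functions concentrated in phase space are determined by finitely many means -/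

theorem norm_fourierChar_sub_one_sq_le (y : ℝ) :
    ‖(Real.fourierChar y : ℂ) - 1‖ ^ 2 ≤ 4 * Real.pi * |y| := by
  have h1 : ‖(Real.fourierChar y : ℂ) - 1‖ ≤ 2 * Real.pi * |y| := by
    have := Real.norm_exp_I_mul_ofReal_sub_one_le (x := 2 * Real.pi * y)
    rw [Real.fourierChar_apply, mul_comm _ Complex.I]
    refine this.trans (le_of_eq ?_)
    rw [Real.norm_eq_abs, abs_mul, abs_of_pos Real.two_pi_pos]
  have h2 : ‖(Real.fourierChar y : ℂ) - 1‖ ≤ 2 := by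
    refine (norm_sub_le _ _).trans ?_
    rw [Circle.norm_coe, norm_one]; norm_num
  have h3 := norm_nonneg ((Real.fourierChar y : ℂ) - 1)
  nlinarith

/-- Translations move `f` little in `L²` if `|ξ| |𝓕 f|²` is integrable. -/
theorem integral_norm_sq_translate_sub_le {f : ℝ → ℂ} (hf : Integrable f) (hf2 : MemLp f 2)
    (hw : Integrable fun ξ => |ξ| * ‖𝓕 f ξ‖ ^ 2) (h : ℝ) :
    ∫ x, ‖f (x + h) - f x‖ ^ 2 ≤ 4 * Real.pi * |h| * ∫ ξ, |ξ| * ‖𝓕 f ξ‖ ^ 2 := by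
  have i1 : Integrable fun x => f (x + h) := hf.comp_add_right h
  have m1 : MemLp (fun x => f (x + h)) 2 :=
    hf2.comp_measurePreserving (measurePreserving_add_right volume h)
  have hF : ∀ ξ, 𝓕 (fun x => f (x + h) - f x) ξ =
      ((Real.fourierChar (h * ξ) : ℂ) - 1) * 𝓕 f ξ := by
    intro ξ
    have h1 : 𝓕 (fun x => f (x + h)) ξ = (Real.fourierChar (h * ξ) : ℂ) * 𝓕 f ξ := by
      have := congrFun (VectorFourier.fourierIntegral_comp_add_right Real.fourierChar volume
        (innerₗ ℝ) f h) ξ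
      have e : innerₗ ℝ h ξ = h * ξ := by simp [mul_comm]
      rw [e] at this
      rw [← smul_eq_mul, ← Circle.smul_def]
      exact this
    have h2 : 𝓕 (fun x => f (x + h) - f x) ξ = 𝓕 (fun x => f (x + h)) ξ - 𝓕 f ξ := by
      simp only [Real.fourier_eq, smul_sub]
      exact integral_sub ((Real.fourierIntegral_convergent_iff ξ).2 i1)
        ((Real.fourierIntegral_convergent_iff ξ).2 hf)
    rw [h2, h1]; ring
  rw [← integral_norm_sq_fourier (f := fun x => f (x + h) - f x) (i1.sub hf) (m1.sub hf2), ← integral_const_mul]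
  refine integral_mono_of_nonneg (Eventually.of_forall fun ξ => by positivity)
    (hw.const_mul _) (Eventually.of_forall fun ξ => ?_)
  dsimp only
  rw [hF, norm_mul, mul_pow]
  calc _ ≤ (4 * Real.pi * |h * ξ|) * ‖𝓕 f ξ‖ ^ 2 :=
        mul_le_mul_of_nonneg_right (norm_fourierChar_sub_one_sq_le _) (by positivity)
    _ = _ := by rw [abs_mul]; ring

/-- A function with mean zero over an interval is bounded, at each point of the interval, by its
mean square oscillation around that point. -/
theorem mul_norm_sq_le_integral_translate {f : ℝ → ℂ} (hf : Continuous f) {a b x : ℝ}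
    (hx : x ∈ Icc a b) (h0 : ∫ y in a..b, f y = 0) :
    (b - a) * ‖f x‖ ^ 2 ≤ ∫ h in (-(b - a))..(b - a), ‖f (x + h) - f x‖ ^ 2 := by
  have hab : a ≤ b := hx.1.trans hx.2
  have hexp : ∀ y, ‖f y - f x‖ ^ 2 = ‖f y‖ ^ 2 - 2 * (innerSL ℝ (f x)) (f y) + ‖f x‖ ^ 2 := by
    intro y
    rw [@norm_sub_sq_real ℂ, real_inner_comm]; rfl
  have h1 : (b - a) * ‖f x‖ ^ 2 ≤ ∫ y in a..b, ‖f y - f x‖ ^ 2 := by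
    simp_rw [hexp]
    rw [intervalIntegral.integral_add
        ((by fun_prop : Continuous fun y =>
          ‖f y‖ ^ 2 - 2 * (innerSL ℝ (f x)) (f y)).intervalIntegrable _ _)
        (continuous_const.intervalIntegrable _ _),
      intervalIntegral.integral_sub
        ((by fun_prop : Continuous fun y => ‖f y‖ ^ 2).intervalIntegrable _ _)
        ((by fun_prop : Continuous fun y => 2 * (innerSL ℝ (f x)) (f y)).intervalIntegrable _ _),
      intervalIntegral.integral_const_mul,
      ContinuousLinearMap.intervalIntegral_comp_comm _ (hf.intervalIntegrable _ _), h0,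
      intervalIntegral.integral_const, map_zero, smul_eq_mul]
    have : 0 ≤ ∫ y in a..b, ‖f y‖ ^ 2 :=
      intervalIntegral.integral_nonneg hab fun y _ => by positivity
    linarith
  refine h1.trans ?_
  have h2 : ∫ y in a..b, ‖f y - f x‖ ^ 2 = ∫ h in (a - x)..(b - x), ‖f (x + h) - f x‖ ^ 2 := by
    rw [intervalIntegral.integral_comp_add_left (fun y => ‖f y - f x‖ ^ 2) x]
    simp
  rw [h2]
  refine intervalIntegral.integral_mono_interval (by linarith [hx.2]) (by linarith)
    (by linarith [hx.1]) (Eventually.of_forall fun y => by positivity)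
    ((by fun_prop : Continuous fun h => ‖f (x + h) - f x‖ ^ 2).intervalIntegrable _ _)

/-- A function whose means over the intervals of length `δ` in `[-L, L]` vanish is small in `L²`
of `[-L, L]`, in terms of a half-derivative. -/
theorem integral_norm_sq_le_of_mean_zero {f : ℝ → ℂ} (hfc : Continuous f) (hf : Integrable f)
    (hf2 : MemLp f 2) (hw : Integrable fun ξ => |ξ| * ‖𝓕 f ξ‖ ^ 2) {L δ : ℝ} (hδ : 0 < δ)
    {n : ℕ} (hn : n * δ = 2 * L)
    (h0 : ∀ i < n, ∫ y in (-L + i * δ)..(-L + (i + 1) * δ), f y = 0) :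
    ∫ x in (-L)..L, ‖f x‖ ^ 2 ≤ 8 * Real.pi * δ * ∫ ξ, |ξ| * ‖𝓕 f ξ‖ ^ 2 := by
  have hL : 0 ≤ L := by
    have : (0 : ℝ) ≤ n * δ := by positivity
    linarith
  set E := ∫ ξ, |ξ| * ‖𝓕 f ξ‖ ^ 2 with hE
  have hE0 : 0 ≤ E := integral_nonneg fun ξ => by positivity
  have hpt : ∀ x ∈ Ioo (-L) L, δ * ‖f x‖ ^ 2 ≤ ∫ h in (-δ)..δ, ‖f (x + h) - f x‖ ^ 2 := by
    intro x hx
    -- the index of the interval containing `x`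
    set i := ⌊(x + L) / δ⌋₊ with hi
    have hq : 0 ≤ (x + L) / δ := div_nonneg (by linarith [hx.1]) hδ.le
    have h1 : (i : ℝ) * δ ≤ x + L := by
      rw [← le_div_iff₀ hδ]; exact Nat.floor_le hq
    have h2 : x + L < (i + 1) * δ := by
      rw [← div_lt_iff₀ hδ]; exact Nat.lt_floor_add_one _
    have h3 : i < n := by
      have : (i : ℝ) * δ < n * δ := by linarith [hx.2]
      exact_mod_cast lt_of_mul_lt_mul_right this hδ.le
    have h4 := mul_norm_sq_le_integral_translate hfc (x := x) ⟨by linarith, by linarith⟩ (h0 i h3)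
    have h5 : -L + (i + 1) * δ - (-L + i * δ) = δ := by ring
    rwa [h5] at h4
  have hG : Continuous fun p : ℝ × ℝ => ‖f (p.1 + p.2) - f p.1‖ ^ 2 := by fun_prop
  have hswap : ∫ x in (-L)..L, ∫ h in (-δ)..δ, ‖f (x + h) - f x‖ ^ 2 =
      ∫ h in (-δ)..δ, ∫ x in (-L)..L, ‖f (x + h) - f x‖ ^ 2 :=
    intervalIntegral_intervalIntegral_swap
      ((hG.continuousOn.integrableOn_compact (isCompact_uIcc.prod isCompact_uIcc)).mono_set
        (prod_mono uIoc_subset_uIcc uIoc_subset_uIcc))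
  have h6 : δ * ∫ x in (-L)..L, ‖f x‖ ^ 2 ≤
      ∫ x in (-L)..L, ∫ h in (-δ)..δ, ‖f (x + h) - f x‖ ^ 2 := by
    rw [← intervalIntegral.integral_const_mul]
    refine intervalIntegral.integral_mono_on_of_le_Ioo (by linarith)
      ((by fun_prop : Continuous fun x => δ * ‖f x‖ ^ 2).intervalIntegrable _ _)
      ((intervalIntegral.continuous_parametric_intervalIntegral_of_continuous' hG
        _ _).intervalIntegrable _ _) hpt
  have h7 : ∫ h in (-δ)..δ, ∫ x in (-L)..L, ‖f (x + h) - f x‖ ^ 2 ≤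
      ∫ h in (-δ)..δ, 4 * Real.pi * δ * E := by
    refine intervalIntegral.integral_mono_on (by linarith)
      ((intervalIntegral.continuous_parametric_intervalIntegral_of_continuous'
        (f := fun h x => ‖f (x + h) - f x‖ ^ 2) (by fun_prop) _ _).intervalIntegrable _ _)
      (continuous_const.intervalIntegrable _ _) fun h hh => ?_
    have m1 : MemLp (fun x => f (x + h) - f x) 2 :=
      (hf2.comp_measurePreserving (measurePreserving_add_right volume h)).sub hf2
    have i1 := (memLp_two_iff_integrable_sq_norm m1.aestronglyMeasurable).1 m1
    rw [intervalIntegral.integral_of_le (by linarith)]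
    refine (setIntegral_le_integral i1 (Eventually.of_forall fun x => by positivity)).trans
      ((integral_norm_sq_translate_sub_le hf hf2 hw h).trans ?_)
    have : |h| ≤ δ := abs_le.2 hh
    have := Real.pi_pos
    gcongr
  rw [hswap] at h6
  have h8 := h6.trans h7
  rw [intervalIntegral.integral_const, smul_eq_mul] at h8
  have h9 : (δ - -δ) * (4 * Real.pi * δ * E) = δ * (8 * Real.pi * δ * E) := by ring
  rw [h9] at h8
  exact le_of_mul_le_mul_left h8 hδ

/-- Functions with `c ‖|x|^½ f‖² + ‖|ξ|^½ 𝓕 f‖² ≤ C ‖f‖²` are determined by finitely many means. -/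
theorem exists_eq_zero_of_mean_zero {c C : ℝ} (hc : 0 < c) (hC : 0 ≤ C) :
    ∃ (n : ℕ) (L δ : ℝ), ∀ f : ℝ → ℂ, Continuous f → Integrable f → MemLp f 2 →
      Integrable (fun x => |x| * ‖f x‖ ^ 2) → Integrable (fun ξ => |ξ| * ‖𝓕 f ξ‖ ^ 2) →
      c * (∫ x, |x| * ‖f x‖ ^ 2) + ∫ ξ, |ξ| * ‖𝓕 f ξ‖ ^ 2 ≤ C * ∫ x, ‖f x‖ ^ 2 →
      (∀ i < n, ∫ y in (-L + i * δ)..(-L + (i + 1) * δ), f y = 0) → f = 0 := by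
  set L := 4 * (C + 1) / c with hL
  have hLpos : 0 < L := by positivity
  have hpi := Real.pi_pos
  obtain ⟨n, hn⟩ := exists_nat_gt (64 * Real.pi * (C + 1) * L)
  have hnpos : (0 : ℝ) < n := lt_trans (by positivity) hn
  refine ⟨n, L, 2 * L / n, fun f hfc hf hf2 hx hξ hle h0 => ?_⟩
  set δ := 2 * L / n with hδ
  have hδpos : 0 < δ := by positivity
  set X := ∫ x, |x| * ‖f x‖ ^ 2 with hX
  set E := ∫ ξ, |ξ| * ‖𝓕 f ξ‖ ^ 2 with hE
  set I := ∫ x, ‖f x‖ ^ 2 with hI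
  have hX0 : 0 ≤ X := integral_nonneg fun ξ => by positivity
  have hE0 : 0 ≤ E := integral_nonneg fun ξ => by positivity
  have hI0 : 0 ≤ I := integral_nonneg fun ξ => by positivity
  have i2 : Integrable fun x => ‖f x‖ ^ 2 :=
    (memLp_two_iff_integrable_sq_norm hf2.aestronglyMeasurable).1 hf2
  have h1 := integral_norm_sq_le_of_mean_zero hfc hf hf2 hξ hδpos (L := L)
    (by rw [hδ]; field_simp) h0
  have hδC : 8 * Real.pi * δ * (C + 1) ≤ 1 / 4 := by
    have e : 8 * Real.pi * δ * (C + 1) = 16 * Real.pi * (C + 1) * L / n := by rw [hδ]; ring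
    rw [e, div_le_iff₀ hnpos]
    linarith
  have hEI : E ≤ (C + 1) * I := by nlinarith
  have h2 : 8 * Real.pi * δ * E ≤ 1 / 4 * I := by
    calc _ ≤ 8 * Real.pi * δ * ((C + 1) * I) := by gcongr
      _ = 8 * Real.pi * δ * (C + 1) * I := by ring
      _ ≤ _ := by gcongr
  have hXI : c * X ≤ (C + 1) * I := by nlinarith
  have hLX : X / L ≤ 1 / 4 * I := by
    rw [div_le_iff₀ hLpos, hL]
    have e : 1 / 4 * I * (4 * (C + 1) / c) = (C + 1) * I / c := by ring
    rw [e, le_div_iff₀ hc]; linarith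
  have h3 : I ≤ (∫ x in (-L)..L, ‖f x‖ ^ 2) + X / L := by
    rw [intervalIntegral.integral_of_le (by linarith), ← integral_indicator measurableSet_Ioc,
      hI, hX, ← integral_div, ← integral_add (i2.indicator measurableSet_Ioc) (hx.div_const L)]
    refine integral_mono i2 ((i2.indicator measurableSet_Ioc).add (hx.div_const L)) fun x => ?_
    dsimp only
    by_cases h : x ∈ Ioc (-L) L
    · rw [indicator_of_mem h]
      exact le_add_of_nonneg_right (by positivity)
    · rw [indicator_of_notMem h, zero_add, le_div_iff₀ hLpos, mul_comm]
      gcongr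
      by_contra hlt
      obtain ⟨a1, a2⟩ := abs_lt.1 (not_le.1 hlt)
      exact h ⟨a1, a2.le⟩
  have hIz : I = 0 := by linarith
  have h4 := (integral_eq_zero_iff_of_nonneg (fun x => by positivity) i2).1 hIz
  have h5 : f =ᵐ[volume] 0 := by
    filter_upwards [h4] with x hx
    simpa using hx
  exact (Continuous.ae_eq_iff_eq volume hfc continuous_const).1 h5

theorem finiteDimensional_of_trivial_ker {V W : Type*} [AddCommGroup V] [Module ℂ V]
    [AddCommGroup W] [Module ℂ W] [FiniteDimensional ℂ W] (Φ : V →ₗ[ℂ] W)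
    (h : ∀ v, Φ v = 0 → v = 0) : FiniteDimensional ℂ V :=
  FiniteDimensional.of_injective Φ ((injective_iff_map_eq_zero Φ).2 h)

/-! ### Finite dimensionality -/

theorem mainTheorem6 (S : ℝ → ℝ) (hS : SubexponentiallyAdmissible S)
    (ν : ℝ → ℝ) (hν_nonneg : ∀ t, 0 ≤ t → 0 ≤ ν t) (hν : Tendsto ν atTop atTop)
    (lam mu : ℤ → ℝ) (hlam : IsOrderedSequence lam) (hmu : IsOrderedSequence mu)
    (N : ℕ)
    (hlam_gap : ∀ j : ℤ, (N : ℤ) ≤ |j| →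
      S (|lam j| + ν |lam j|) * (lam (j + 1) - lam j) ≤ 1 / 2)
    (hmu_gap : ∀ j : ℤ, (N : ℤ) ≤ |j| →
      increasingInverse S (|mu j| + ν |mu j|) * (mu (j + 1) - mu j) ≤ 1 / 2) :
    FiniteDimensional ℂ (vanishingSpace (range lam) (range mu)) := by
  obtain ⟨c, C, hc, hC, hest⟩ := exists_coercive_estimate hS hν hlam hmu hlam_gap hmu_gap
  obtain ⟨n, L, δ, hzero⟩ := exists_eq_zero_of_mean_zero hc hC
  have hmem : ∀ f : vanishingSpace (range lam) (range mu), MemFourierSobolev (f.1 : ℝ → ℂ) :=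
    fun f => f.1.2
  have hint : ∀ (f : vanishingSpace (range lam) (range mu)) (a b : ℝ),
      IntervalIntegrable (f.1 : ℝ → ℂ) volume a b :=
    fun f a b => (hmem f).continuous.intervalIntegrable a b
  let Φ : vanishingSpace (range lam) (range mu) →ₗ[ℂ] (Fin n → ℂ) :=
    { toFun := fun f i => ∫ y in (-L + (i : ℕ) * δ)..(-L + ((i : ℕ) + 1) * δ), (f.1 : ℝ → ℂ) y
      map_add' := fun f g => funext fun i => intervalIntegral.integral_add (hint f _ _) (hint g _ _)
      map_smul' := fun z f => funext fun i =>
        intervalIntegral.integral_smul z (fun y => (f.1 : ℝ → ℂ) y) }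
  refine finiteDimensional_of_trivial_ker Φ fun f hf => ?_
  have hm := hmem f
  have hx : Integrable fun x => |x| * ‖(f.1 : ℝ → ℂ) x‖ ^ 2 :=
    hm.integrable_of_le (D := 1) (by fun_prop) fun x => by
      rw [abs_abs, one_mul]; exact abs_le_one_add_sq x
  have hξ : Integrable fun x => |x| * ‖𝓕 (f.1 : ℝ → ℂ) x‖ ^ 2 :=
    hm.integrable_fourier_of_le (D := 1) (by fun_prop) fun x => by
      rw [abs_abs, one_mul]; exact abs_le_one_add_sq x
  exact Subtype.ext (Subtype.ext (hzero _ hm.continuous hm.integrable hm.memLp hx hξ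
    (hest _ hm (fun j => f.2.1 _ (mem_range_self j)) fun j => f.2.2 _ (mem_range_self j))
    fun i hi => congrFun hf ⟨i, hi⟩))
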